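/- Let $G$ be an infinite compact (Hausdorff) abelian group with normalized Haar measure $m$, let $\Gamma$ be its dual group, i.e. the group of all continuous homomorphisms from $G$ into the circle group $\mathbb T$, let $\Lambda\subset\Gamma$, and put $\Lambda^{-1}=\{\gamma^{-1}:\gamma\in\Lambda\}$. Let $C(G)$ be the Banach space of continuous functions $f:G\to\mathbb C$ with the supremum norm and $$C_\Lambda(G)=\Bigl\{f\in C(G):\ \int_G f\,\overline{\gamma}\,dm=0\ \text{ for all }\gamma\in\Gamma\setminus\Lambda\Bigr\}.$$ Then $C_\Lambda(G)$ is a rich subspace of $C(G)$ if and only if $\Gamma\setminus\Lambda^{-1}$ is a semi-Riesz set. Here a Banach space $X$ has the Daugavet property if $\|\mathrm{Id}+T\|=1+\|T\|$ for every bounded linear operator $T:X\to X$ of rank one. A closed subspace $Y$ of a Banach space $X$ with the Daugavet property is called rich in $X$ if the quotient map $\pi:X\to X/Y$ is narrow, that is, if for all $x,y\in X$ with $\|x\|=\|y\|=1$, every $x^*\in X^*$ and every $\varepsilon>0$ there is $z\in X$ with $\|z\|=1$, $\|\pi(y-z)\|+|x^*(y-z)|\le\varepsilon$ and $\|x+z\|\ge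 2-\varepsilon$; in particular, the assertion that $Y$ is rich in $X$ includes that $X$ has the Daugavet property and that $Y$ is closed. A set $\Theta\subset\Gamma$ is a semi-Riesz set if every regular complex Borel measure $\mu$ on $G$ with $\int_G\overline{\gamma}\,d\mu=0$ for all $\gamma\in\Gamma\setminus\Theta$ is diffuse, i.e. satisfies $\mu(B)=0$ for all countable sets $B\subset G$. -/

import Mathlib

open MeasureTheory
open scoped Pointwise ComplexConjugate

namespace HarmonicBanach

noncomputable section

/-! ### The Daugavet property, narrow operators and rich subspaces -/

section Banach

variable (X : Type*) [NormedAddCommGroup X] [NormedSpace ℂ X]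

/-- A Banach space `X` has the Daugavet property if every bounded operator `T` on `X` of rank one
satisfies the Daugavet equation `‖Id + T‖ = 1 + ‖T‖`. -/
def HasDaugavetProperty : Prop :=
  ∀ T : X →L[ℂ] X, Module.finrank ℂ (LinearMap.range (T : X →ₗ[ℂ] X)) = 1 →
    ‖ContinuousLinearMap.id ℂ X + T‖ = 1 + ‖T‖

variable {X}

/-- A bounded operator `T` is narrow if for all `x, y` in the unit sphere of `X`, every
continuous linear functional `φ` and every `ε > 0` there is `z` in the unit sphere with
`‖T (y - z)‖ + |φ (y - z)| ≤ ε` and `‖x + z‖ ≥ 2 - ε`. -/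
def IsNarrow {E : Type*} [SeminormedAddCommGroup E] [NormedSpace ℂ E] (T : X →L[ℂ] E) : Prop :=
  ∀ x ∈ Metric.sphere (0 : X) 1, ∀ y ∈ Metric.sphere (0 : X) 1, ∀ φ : X →L[ℂ] ℂ,
    ∀ ε : ℝ, 0 < ε → ∃ z ∈ Metric.sphere (0 : X) 1,
      ‖T (y - z)‖ + ‖φ (y - z)‖ ≤ ε ∧ 2 - ε ≤ ‖x + z‖

/-- `Y` is a rich subspace of the Banach space `X`: the ambient space `X` has the Daugavet
property, `Y` is closed, and the quotient map `X → X ⧸ Y` (with the quotient norm on `X ⧸ Y`)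
is narrow. -/
structure IsRich (Y : Submodule ℂ X) : Prop where
  daugavet : HasDaugavetProperty X
  isClosed : IsClosed (Y : Set X)
  narrow : IsNarrow Y.mkQL

end Banach

/-! ### Spectra of functions and measures on a compact abelian group -/

section Group

variable {G : Type*} [CommGroup G] [TopologicalSpace G] [IsTopologicalGroup G] [CompactSpace G]
  [MeasurableSpace G] [BorelSpace G]

variable (G) in
/-- The Haar measure of `G`, normalized to have total mass one. -/
def normalizedHaar : Measure G := Measure.haarMeasure (⊤ : TopologicalSpace.PositiveCompacts G)

/-- The Fourier coefficient `∫ conj γ · f dm` of a continuous function `f`. -/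
def fourierCoefficient (f : C(G, ℂ)) (γ : PontryaginDual G) : ℂ :=
  ∫ x, conj (γ x : ℂ) * f x ∂(normalizedHaar G)

/-- The spectrum of a continuous function. -/
def spec (f : C(G, ℂ)) : Set (PontryaginDual G) :=
  {γ | fourierCoefficient f γ ≠ 0}

instance : IsFiniteMeasure (normalizedHaar G) := by
  unfold normalizedHaar
  infer_instance

instance : IsProbabilityMeasure (normalizedHaar G) :=
  ⟨by simpa [normalizedHaar] using
    Measure.haarMeasure_self (K₀ := (⊤ : TopologicalSpace.PositiveCompacts G))⟩

lemma integrable_conj_mul (f : C(G, ℂ)) (γ : PontryaginDual G) :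
    Integrable (fun x => conj (γ x : ℂ) * f x) (normalizedHaar G) := by
  have hc : Continuous (fun x => conj (γ x : ℂ) * f x) :=
    (Complex.continuous_conj.comp (continuous_subtype_val.comp (map_continuous γ))).mul
      f.continuous
  exact hc.integrable_of_hasCompactSupport (HasCompactSupport.of_compactSpace _)

lemma fourierCoefficient_zero (γ : PontryaginDual G) :
    fourierCoefficient (0 : C(G, ℂ)) γ = 0 := by
  simp [fourierCoefficient]

lemma fourierCoefficient_add (f g : C(G, ℂ)) (γ : PontryaginDual G) :
    fourierCoefficient (f + g) γ = fourierCoefficient f γ + fourierCoefficient g γ := by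
  simp only [fourierCoefficient, ContinuousMap.add_apply, mul_add]
  exact integral_add (integrable_conj_mul f γ) (integrable_conj_mul g γ)

lemma fourierCoefficient_smul (c : ℂ) (f : C(G, ℂ)) (γ : PontryaginDual G) :
    fourierCoefficient (c • f) γ = c * fourierCoefficient f γ := by
  simp only [fourierCoefficient, ContinuousMap.smul_apply, smul_eq_mul, mul_left_comm _ c]
  exact integral_const_mul c _

/-- `C_Λ(G)`: the continuous functions on `G` with spectrum contained in `Λ`. -/
def continuousWithSpec (Λ : Set (PontryaginDual G)) : Submodule ℂ C(G, ℂ) where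
  carrier := {f | spec f ⊆ Λ}
  zero_mem' := fun γ hγ => (hγ (fourierCoefficient_zero γ)).elim
  add_mem' := by
    intro f g hf hg γ hγ
    by_contra h
    have h1 : fourierCoefficient f γ = 0 := by_contra fun h' => h (hf h')
    have h2 : fourierCoefficient g γ = 0 := by_contra fun h' => h (hg h')
    exact hγ (by rw [fourierCoefficient_add, h1, h2, add_zero])
  smul_mem' := by
    intro c f hf γ hγ
    refine hf fun h => hγ ?_
    rw [fourierCoefficient_smul, h, mul_zero]

end Group

section Measures

variable {G : Type*} [CommGroup G] [TopologicalSpace G] [MeasurableSpace G]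

/-- A complex Borel measure is regular if its total variation is a regular measure. The space
`M(G)` consists of the regular complex Borel measures on `G`. -/
def IsRegularMeasure (μ : ComplexMeasure G) : Prop := μ.variation.Regular

/-- The Fourier-Stieltjes transform `∫ conj γ dμ` of a complex measure. -/
def fourierStieltjes (μ : ComplexMeasure G) (γ : PontryaginDual G) : ℂ :=
  μ.integral (fun x => conj (γ x : ℂ)) (ContinuousLinearMap.mul ℝ ℂ)

/-- The spectrum of a complex measure. -/
def measureSpec (μ : ComplexMeasure G) : Set (PontryaginDual G) :=
  {γ | fourierStieltjes μ γ ≠ 0}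

/-- A complex measure is diffuse (non-atomic) if it vanishes on all countable sets. -/
def IsDiffuse (μ : ComplexMeasure G) : Prop :=
  ∀ B : Set G, B.Countable → μ B = 0

/-- `Λ` is a semi-Riesz set if every `μ ∈ M(G)` with spectrum contained in `Λ` is diffuse. -/
def IsSemiRiesz (Λ : Set (PontryaginDual G)) : Prop :=
  ∀ μ : ComplexMeasure G, IsRegularMeasure μ → measureSpec μ ⊆ Λ → IsDiffuse μ

end Measures

end

end HarmonicBanach

set_option linter.unusedSectionVars false

namespace HarmonicBanach

/-! ### Complex measures and the Riesz representation theorem -/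

section RegularMeasure

open scoped ENNReal NNReal

variable {K : Type*} [TopologicalSpace K] [MeasurableSpace K] [BorelSpace K]

/-! Via the Riesz representation theorem, the annihilator of `C_Λ(G)` consists of the regular
measures with spectrum off `Λ⁻¹` (`measureSpec_subset_iff`). The theorem thus says that the quotient
map is narrow exactly when no annihilating measure has an atom.

If the quotient map is narrow, iterating narrowness yields bounded functions that peak inside a
prescribed open set and lie close to `C_Λ(G)` (`IsNarrow.exists_peak`). As `C_Λ(G)` is translation
invariant, the peak can be moved to any point `x`. An annihilating `μ` almost kills such a function,
yet its integral is almost `μ {x}`.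

Conversely, let annihilating measures be diffuse. Given an open set and a functional `φ`, pick a
point `t` of the set that is not an atom of the measure of `φ`. If no bump at `t` were almost killed
by both the quotient map and `φ`, Hahn-Banach would give a functional, a sum of an annihilating one
and a multiple of `φ`, bounded below on all these bumps. Neither measure charges `t`, so narrow
bumps refute this. Such bumps suffice for narrowness (`isNarrow_of_exists_bump`), and narrowness
implies the Daugavet property.

Identifying the annihilator needs the characters to separate points. This comes from Gelfand theory
for the commutative algebra generated by the translations of `L²(G)`. -/

lemma regular_of_le [R1Space K] {μ ν : Measure K} [ν.Regular] [IsFiniteMeasure ν] (h : μ ≤ ν) :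
    μ.Regular := by
  have : IsFiniteMeasure μ := isFiniteMeasure_of_le ν h
  -- For finite measures, approximation by compact sets from inside is enough, and a compact set
  -- that exhausts `A` up to small `ν`-measure does so for `μ`.
  have : μ.InnerRegularCompactLTTop := by
    refine ⟨fun A hA r hr => ?_⟩
    obtain ⟨F, hFA, hF, hFc, hlt⟩ := hA.1.exists_isCompact_isClosed_sdiff_lt (μ := ν)
      (measure_ne_top ν A) (tsub_pos_of_lt hr).ne'
    refine ⟨F, hFA, hF, ?_⟩
    have h1 : μ A ≤ μ F + μ (A \ F) := by
      rw [← measure_sdiff_add_inter A hFc.measurableSet, add_comm]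
      exact add_le_add_left (measure_mono Set.inter_subset_right) _
    have h2 : μ (A \ F) < μ A - r := (h _).trans_lt hlt
    by_contra! hle
    have h3 : μ A < r + (μ A - r) :=
      h1.trans_lt (ENNReal.add_lt_add_of_le_of_lt (ne_top_of_le_ne_top hr.ne_top hle) hle h2)
    rw [add_tsub_cancel_of_le hr.le] at h3
    exact h3.false
  infer_instance

end RegularMeasure

/-! ### Complex multiples of positive measures. -/

section SmulMeasure

variable {K : Type*} [MeasurableSpace K]

/-- The complex measure `c • ν` for a finite positive measure `ν` and a complex number `c`. -/
noncomputable def complexSMulMeasure (c : ℂ) (ν : Measure K) [IsFiniteMeasure ν] :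
    ComplexMeasure K :=
  ν.toSignedMeasure.mapRange (ContinuousLinearMap.toSpanSingleton ℝ c).toLinearMap.toAddMonoidHom
    (ContinuousLinearMap.toSpanSingleton ℝ c).continuous

lemma complexSMulMeasure_apply (c : ℂ) (ν : Measure K) [IsFiniteMeasure ν] {s : Set K}
    (hs : MeasurableSet s) : complexSMulMeasure c ν s = (ν.real s : ℂ) * c := by
  simp [complexSMulMeasure, VectorMeasure.mapRange_apply, Measure.toSignedMeasure_apply_measurable hs]

lemma variation_complexSMulMeasure_le (c : ℂ) (ν : Measure K) [IsFiniteMeasure ν] :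
    (complexSMulMeasure c ν).variation ≤ ‖c‖ₑ • ν := by
  refine VectorMeasure.variation_le_of_forall_enorm_le fun s hs => ?_
  rw [complexSMulMeasure_apply c ν hs, enorm_mul, mul_comm, Measure.smul_apply, smul_eq_mul]
  gcongr
  rw [← ofReal_norm, Complex.norm_real, Real.norm_of_nonneg measureReal_nonneg,
    ofReal_measureReal]

/-- The integral is a `setToFun` over the variation; since the variation is at most `‖c‖ₑ • ν`, it
can be computed over `ν`, where induction on integrable functions applies. -/
lemma integral_complexSMulMeasure (c : ℂ) (ν : Measure K) [IsFiniteMeasure ν] {f : K → ℂ}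
    (hf : Integrable f ν) :
    (complexSMulMeasure c ν).integral f (ContinuousLinearMap.mul ℝ ℂ) = c * ∫ x, f x ∂ν := by
  have hT : DominatedFinMeasAdditive ν
      ((complexSMulMeasure c ν).transpose (ContinuousLinearMap.mul ℝ ℂ)) ‖c‖ := by
    refine ⟨fun s t hs ht _ _ hdisj => ?_, fun s hs _ => ?_⟩
    · rw [transpose_eq_cbmApplyMeasure]
      exact cbmApplyMeasure_union _ _ hs ht hdisj
    · rw [transpose_eq_cbmApplyMeasure]
      refine (norm_cbmApplyMeasure_le _ _ _).trans (le_of_eq ?_)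
      rw [complexSMulMeasure_apply c ν hs, ContinuousLinearMap.opNorm_mul, one_mul, norm_mul,
        Complex.norm_real, Real.norm_of_nonneg measureReal_nonneg, mul_comm]
  have key : (complexSMulMeasure c ν).integral f (ContinuousLinearMap.mul ℝ ℂ) =
      setToFun ν _ hT f :=
    (setToFun_congr_measure_of_integrable ‖c‖ₑ (by simp) (variation_complexSMulMeasure_le c ν) hT
      (dominatedFinMeasAdditive_cbmApplyMeasure _ _) f hf).symm
  rw [key]
  refine Integrable.induction (μ := ν) (fun f => setToFun ν _ hT f = c * ∫ x, f x ∂ν)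
    ?_ ?_ ?_ ?_ hf
  · intro a s hs hsν
    rw [setToFun_indicator_const hT hs hsν.ne, integral_indicator_const _ hs,
      transpose_eq_cbmApplyMeasure, cbmApplyMeasure_apply, complexSMulMeasure_apply c ν hs]
    simp
    ring
  · intro f g _ hf hg hf' hg'
    rw [setToFun_add hT hf hg, hf', hg', ← mul_add]
    exact congrArg _ (integral_add hf hg).symm
  · exact isClosed_eq (continuous_setToFun hT) (continuous_const.mul continuous_integral)
  · intro f g hfg _ h
    rw [← setToFun_congr_ae hT hfg, h, integral_congr_ae hfg]

end SmulMeasure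

/-! ### The Jordan decomposition of a real functional. -/

section PosPart

variable {K : Type*} [TopologicalSpace K] [CompactSpace K]

/-- The positive part of a bounded functional `u` on `C(K, ℝ)`, on nonnegative functions. -/
noncomputable def posPartFunctional (u : C(K, ℝ) →L[ℝ] ℝ) (f : C(K, ℝ)) : ℝ :=
  sSup (u '' Set.Icc 0 f)

variable (u : C(K, ℝ) →L[ℝ] ℝ)

lemma bddAbove_image_Icc (f : C(K, ℝ)) : BddAbove (u '' Set.Icc 0 f) := by
  refine ⟨‖u‖ * ‖f‖, ?_⟩
  rintro _ ⟨g, ⟨hg0, hgf⟩, rfl⟩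
  refine (le_abs_self _).trans ((u.le_opNorm g).trans ?_)
  gcongr
  refine (ContinuousMap.norm_le _ (norm_nonneg f)).2 fun x => ?_
  refine (Real.norm_of_nonneg (hg0 x)).le.trans ?_
  exact (hgf x).trans ((le_abs_self _).trans (f.norm_coe_le_norm x))

lemma posPartFunctional_nonneg {f : C(K, ℝ)} (hf : 0 ≤ f) : 0 ≤ posPartFunctional u f :=
  le_csSup (bddAbove_image_Icc u f) ⟨0, ⟨le_rfl, hf⟩, map_zero u⟩

lemma le_posPartFunctional {f : C(K, ℝ)} (hf : 0 ≤ f) : u f ≤ posPartFunctional u f :=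
  le_csSup (bddAbove_image_Icc u f) ⟨f, ⟨hf, le_rfl⟩, rfl⟩

/-- Riesz decomposition: `k` in `[0, f + g]` splits as `k ⊓ f` plus `k - k ⊓ f`, so the order
interval is a Minkowski sum and the suprema add. -/
lemma posPartFunctional_add {f g : C(K, ℝ)} (hf : 0 ≤ f) (hg : 0 ≤ g) :
    posPartFunctional u (f + g) = posPartFunctional u f + posPartFunctional u g := by
  have hI : Set.Icc 0 (f + g) = Set.Icc 0 f + Set.Icc 0 g := by
    ext k
    constructor
    · rintro ⟨h0, h1⟩
      refine ⟨k ⊓ f, ⟨le_inf h0 hf, inf_le_right⟩, k - k ⊓ f, ⟨sub_nonneg.2 inf_le_left, ?_⟩, by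
        simp⟩
      intro x
      have h2 : k x ≤ f x + g x := h1 x
      have h3 : 0 ≤ g x := hg x
      change k x - min (k x) (f x) ≤ g x
      rcases min_cases (k x) (f x) with h | h <;> linarith
    · rintro ⟨a, ha, b, hb, rfl⟩
      exact ⟨add_nonneg ha.1 hb.1, add_le_add ha.2 hb.2⟩
  unfold posPartFunctional
  rw [hI, Set.image_add]
  exact csSup_add ⟨_, 0, ⟨le_rfl, hf⟩, rfl⟩ (bddAbove_image_Icc u f) ⟨_, 0, ⟨le_rfl, hg⟩, rfl⟩
    (bddAbove_image_Icc u g)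

lemma posPartFunctional_smul {c : ℝ} (hc : 0 ≤ c) (f : C(K, ℝ)) :
    posPartFunctional u (c • f) = c * posPartFunctional u f := by
  rcases hc.eq_or_lt with rfl | hc
  · simp [posPartFunctional]
  have hI : u '' Set.Icc 0 (c • f) = c • (u '' Set.Icc 0 f) := by
    ext r
    constructor
    · rintro ⟨g, ⟨h0, h1⟩, rfl⟩
      refine ⟨_, ⟨c⁻¹ • g, ⟨smul_nonneg (inv_nonneg.2 hc.le) h0, ?_⟩, rfl⟩, by
        simp [hc.ne']⟩
      intro x
      have h2 : g x ≤ c * f x := h1 x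
      change c⁻¹ * g x ≤ f x
      rwa [inv_mul_le_iff₀ hc]
    · rintro ⟨_, ⟨g, ⟨h0, h1⟩, rfl⟩, rfl⟩
      exact ⟨c • g, ⟨smul_nonneg hc.le h0, smul_le_smul_of_nonneg_left h1 hc.le⟩, by simp⟩
  rw [posPartFunctional, hI, Real.sSup_smul_of_nonneg hc.le, smul_eq_mul, posPartFunctional]

end PosPart

/-! ### Riesz representation on a compact Hausdorff space. -/

section Riesz

open scoped ENNReal NNReal

variable {K : Type*} [TopologicalSpace K] [CompactSpace K] [T2Space K] [MeasurableSpace K]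
  [BorelSpace K]

/-- The Riesz-Markov-Kakutani theorem for functionals given on nonnegative functions. -/
lemma exists_measure_of_posFunctional (p : C(K, ℝ) → ℝ) (h0 : ∀ f, 0 ≤ f → 0 ≤ p f)
    (hadd : ∀ f g, 0 ≤ f → 0 ≤ g → p (f + g) = p f + p g)
    (hsmul : ∀ c : ℝ, 0 ≤ c → ∀ f, 0 ≤ f → p (c • f) = c * p f) :
    ∃ ν : Measure K, ν.Regular ∧ IsFiniteMeasure ν ∧
      ∀ f : C(K, ℝ), 0 ≤ f → ∫ x, f x ∂ν = p f := by
  let j (f : C(K, ℝ≥0)) : C(K, ℝ) := ⟨fun x => (f x : ℝ), by fun_prop⟩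
  have hj (f : C(K, ℝ≥0)) : 0 ≤ j f := fun x => (f x).2
  -- Additivity on the positive cone is precisely `ℝ≥0`-linearity, so `p` need not be extended to
  -- all of `C(K, ℝ)`.
  let P : CompactlySupportedContinuousMap K ℝ≥0 →ₗ[ℝ≥0] ℝ≥0 :=
    { toFun := fun f => ⟨p (j f.toContinuousMap), h0 _ (hj _)⟩
      map_add' := fun f g => NNReal.eq (hadd _ _ (hj _) (hj _))
      map_smul' := fun c f => NNReal.eq (hsmul c c.2 _ (hj _)) }
  have hreg : (NNRealRMK.rieszMeasure P).Regular := NNRealRMK.rieszMeasure_regular P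
  refine ⟨NNRealRMK.rieszMeasure P, hreg, ⟨isCompact_univ.measure_lt_top⟩, fun f hf => ?_⟩
  let f' : C(K, ℝ≥0) := ⟨fun x => (f x).toNNReal, by fun_prop⟩
  have hf' : j f' = f := ContinuousMap.ext fun x => Real.coe_toNNReal _ (hf x)
  have h := NNRealRMK.integral_rieszMeasure P
    (CompactlySupportedContinuousMap.continuousMapEquiv f')
  have h1 : ((P (CompactlySupportedContinuousMap.continuousMapEquiv f') : ℝ≥0) : ℝ) = p f := by
    conv_rhs => rw [← hf']
    rfl
  rw [h1] at h
  rw [← h]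
  refine integral_congr_ae (Filter.Eventually.of_forall fun x => ?_)
  exact (Real.coe_toNNReal _ (hf x)).symm

lemma integrable_continuousMap {E : Type*} [NormedAddCommGroup E] (ν : Measure K)
    [IsFiniteMeasure ν] (f : C(K, E)) : Integrable f ν :=
  f.continuous.integrable_of_hasCompactSupport (HasCompactSupport.of_compactSpace _)

/-- Both `u⁺` and `u⁺ - u` are positive on the cone, and every `f` is a difference of nonnegative
functions. -/
lemma exists_measures_of_real_functional (u : C(K, ℝ) →L[ℝ] ℝ) :
    ∃ ν₁ ν₂ : Measure K, ν₁.Regular ∧ IsFiniteMeasure ν₁ ∧ ν₂.Regular ∧ IsFiniteMeasure ν₂ ∧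
      ∀ f : C(K, ℝ), u f = ∫ x, f x ∂ν₁ - ∫ x, f x ∂ν₂ := by
  obtain ⟨ν₁, hr₁, hf₁, h₁⟩ := exists_measure_of_posFunctional (posPartFunctional u)
    (fun f => posPartFunctional_nonneg u) (fun f g => posPartFunctional_add u)
    (fun c hc f _ => posPartFunctional_smul u hc f)
  obtain ⟨ν₂, hr₂, hf₂, h₂⟩ := exists_measure_of_posFunctional
    (fun f => posPartFunctional u f - u f)
    (fun f hf => sub_nonneg.2 (le_posPartFunctional u hf))
    (fun f g hf hg => by rw [posPartFunctional_add u hf hg, map_add]; ring)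
    (fun c hc f _ => by
      rw [posPartFunctional_smul u hc f, map_smul, smul_eq_mul]; ring)
  refine ⟨ν₁, ν₂, hr₁, hf₁, hr₂, hf₂, fun f => ?_⟩
  have hpos : ∀ f : C(K, ℝ), 0 ≤ f → u f = ∫ x, f x ∂ν₁ - ∫ x, f x ∂ν₂ := fun f hf => by
    rw [h₁ f hf, h₂ f hf]; ring
  have hd : f = f ⊔ 0 - (-f) ⊔ 0 := by
    ext x
    change f x = max (f x) 0 - max (-f x) 0
    rcases max_cases (f x) 0 with h | h <;> rcases max_cases (-f x) 0 with h' | h' <;> linarith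
  have hi (ν : Measure K) [IsFiniteMeasure ν] :
      ∫ x, f x ∂ν = ∫ x, (f ⊔ 0) x ∂ν - ∫ x, ((-f) ⊔ 0) x ∂ν := by
    rw [← integral_sub (integrable_continuousMap ν _) (integrable_continuousMap ν _)]
    exact congrArg (fun g : C(K, ℝ) => ∫ x, g x ∂ν) hd
  have hu : u f = u (f ⊔ 0) - u ((-f) ⊔ 0) := by
    rw [← map_sub]; exact congrArg u hd
  rw [hi ν₁, hi ν₂, hu, hpos _ le_sup_right, hpos _ le_sup_right]
  ring

/-- The integral of a continuous function with respect to a complex measure. -/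
noncomputable def pairing {K : Type*} [TopologicalSpace K] [MeasurableSpace K]
    (μ : ComplexMeasure K) (f : C(K, ℂ)) : ℂ :=
  μ.integral f (ContinuousLinearMap.mul ℝ ℂ)

/-- The Riesz representation theorem for bounded functionals on `C(K, ℂ)`. -/
theorem exists_complexMeasure_of_functional (ψ : C(K, ℂ) →L[ℂ] ℂ) :
    ∃ μ : ComplexMeasure K, IsRegularMeasure μ ∧ ∀ f, ψ f = pairing μ f := by
  let J : C(K, ℝ) →L[ℝ] C(K, ℂ) := Complex.ofRealCLM.compLeftContinuous ℝ K
  obtain ⟨a₁, a₂, _, _, _, _, ha⟩ := exists_measures_of_real_functional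
    (Complex.reCLM.comp ((ψ.restrictScalars ℝ).comp J))
  obtain ⟨b₁, b₂, _, _, _, _, hb⟩ := exists_measures_of_real_functional
    (Complex.imCLM.comp ((ψ.restrictScalars ℝ).comp J))
  let μ : ComplexMeasure K := (complexSMulMeasure 1 a₁ + complexSMulMeasure (-1) a₂) +
    (complexSMulMeasure Complex.I b₁ + complexSMulMeasure (-Complex.I) b₂)
  have hle (c : ℂ) (hc : ‖c‖ = 1) (ν : Measure K) [IsFiniteMeasure ν] :
      (complexSMulMeasure c ν).variation ≤ ν := by
    refine (variation_complexSMulMeasure_le c ν).trans (le_of_eq ?_)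
    rw [← ofReal_norm, hc, ENNReal.ofReal_one, one_smul]
  -- Domination by a finite sum of regular measures makes `μ` regular, by `regular_of_le`.
  have hvar : μ.variation ≤ (a₁ + a₂) + (b₁ + b₂) := by
    refine VectorMeasure.variation_add_le.trans (add_le_add ?_ ?_) <;>
      refine VectorMeasure.variation_add_le.trans (add_le_add ?_ ?_) <;>
      exact hle _ (by simp) _
  have hint (c : ℂ) (hc : ‖c‖ = 1) (ν : Measure K) [IsFiniteMeasure ν] (f : C(K, ℂ)) :
      (complexSMulMeasure c ν).Integrable f :=
    (integrable_continuousMap ν f).mono_measure (hle c hc ν)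
  refine ⟨μ, ?_, fun f => ?_⟩
  · have : ((a₁ + a₂) + (b₁ + b₂)).Regular := inferInstance
    exact regular_of_le hvar
  · have hre (g : C(K, ℝ)) : ψ (J g) = (∫ x, (g x : ℂ) ∂a₁ - ∫ x, (g x : ℂ) ∂a₂) +
        Complex.I * (∫ x, (g x : ℂ) ∂b₁ - ∫ x, (g x : ℂ) ∂b₂) := by
      have h1 : (ψ (J g)).re = ∫ x, g x ∂a₁ - ∫ x, g x ∂a₂ := ha g
      have h2 : (ψ (J g)).im = ∫ x, g x ∂b₁ - ∫ x, g x ∂b₂ := hb g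
      rw [← Complex.re_add_im (ψ (J g)), h1, h2]
      simp only [integral_complex_ofReal]
      push_cast
      ring
    let fr : C(K, ℝ) := ⟨fun x => (f x).re, by fun_prop⟩
    let fi : C(K, ℝ) := ⟨fun x => (f x).im, by fun_prop⟩
    have hf : f = J fr + Complex.I • J fi := by
      ext x
      change f x = (f x).re + Complex.I * (f x).im
      rw [mul_comm, Complex.re_add_im]
    have hfi (ν : Measure K) [IsFiniteMeasure ν] :
        ∫ x, f x ∂ν = ∫ x, (fr x : ℂ) ∂ν + Complex.I * ∫ x, (fi x : ℂ) ∂ν := by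
      rw [← integral_const_mul]
      exact (congrArg (fun g : C(K, ℂ) => ∫ x, g x ∂ν) hf).trans
        (integral_add (integrable_continuousMap ν (J fr))
          ((integrable_continuousMap ν (J fi)).const_mul _))
    have hψ : ψ f = ψ (J fr) + Complex.I * ψ (J fi) := by
      rw [← smul_eq_mul, ← map_smul, ← map_add, ← hf]
    have h1 : ‖(-1 : ℂ)‖ = 1 := by simp
    have h2 : ‖(-Complex.I : ℂ)‖ = 1 := by simp
    have h3 : ‖(1 : ℂ)‖ = 1 := by simp
    have h4 : ‖(Complex.I : ℂ)‖ = 1 := by simp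
    rw [pairing, VectorMeasure.integral_add_vectorMeasure
        ((hint _ h3 _ f).add_vectorMeasure (hint _ h1 _ f))
        ((hint _ h4 _ f).add_vectorMeasure (hint _ h2 _ f)),
      VectorMeasure.integral_add_vectorMeasure (hint _ h3 _ f) (hint _ h1 _ f),
      VectorMeasure.integral_add_vectorMeasure (hint _ h4 _ f) (hint _ h2 _ f)]
    simp only [integral_complexSMulMeasure _ _ (integrable_continuousMap _ f)]
    rw [hψ, hre, hre, hfi a₁, hfi a₂, hfi b₁, hfi b₂]
    ring

variable {μ : ComplexMeasure K}

lemma IsRegularMeasure.isFiniteMeasure_variation (hμ : IsRegularMeasure μ) :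
    IsFiniteMeasure μ.variation :=
  have : μ.variation.Regular := hμ
  ⟨isCompact_univ.measure_lt_top⟩

lemma norm_pairing_le (μ : ComplexMeasure K) (f : C(K, ℂ)) :
    ‖pairing μ f‖ ≤ ∫ x, ‖f x‖ ∂μ.variation := by
  simpa [pairing] using VectorMeasure.norm_integral_le_integral_norm (μ := μ) (f := f)
    (B := ContinuousLinearMap.mul ℝ ℂ)

/-- The functional on `C(K, ℂ)` given by integration against a regular complex measure. -/
noncomputable def pairingCLM (hμ : IsRegularMeasure μ) : C(K, ℂ) →L[ℂ] ℂ :=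
  have := hμ.isFiniteMeasure_variation
  LinearMap.mkContinuous
    { toFun := pairing μ
      map_add' := fun f g => VectorMeasure.integral_add (integrable_continuousMap _ f)
        (integrable_continuousMap _ g)
      map_smul' := fun c f => by
        refine setToFun_smul (𝕜 := ℂ) _ (fun c s x => ?_) c f
        rw [transpose_eq_cbmApplyMeasure, cbmApplyMeasure_apply, cbmApplyMeasure_apply]
        simp [mul_assoc] }
    (μ.variation.real Set.univ) fun f => by
      refine (norm_pairing_le μ f).trans ?_
      refine (integral_mono (integrable_continuousMap _ f).norm (integrable_const ‖f‖)
        fun x => f.norm_coe_le_norm x).trans ?_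
      simp

@[simp]
lemma pairingCLM_apply (hμ : IsRegularMeasure μ) (f : C(K, ℂ)) :
    pairingCLM hμ f = pairing μ f := rfl

lemma variation_singleton_eq_zero {t : K} (h : μ {t} = 0) : μ.variation {t} = 0 := by
  rw [VectorMeasure.variation_apply_eq_zero (measurableSet_singleton t)]
  intro s hs _
  rcases Set.subset_singleton_iff_eq.1 hs with rfl | rfl
  · exact μ.empty
  · exact h

end Riesz

/-! ### Characters of a compact abelian group -/

section Haar

variable {G : Type*} [CommGroup G] [TopologicalSpace G] [IsTopologicalGroup G] [CompactSpace G]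
  [MeasurableSpace G] [BorelSpace G]

instance : (normalizedHaar G).IsHaarMeasure := by
  unfold normalizedHaar
  infer_instance

instance : (normalizedHaar G).Regular := by
  unfold normalizedHaar
  infer_instance

end Haar

/-! ### The regular representation on `L²(G)`. -/

section Regular

variable {G : Type*} [CommGroup G] [TopologicalSpace G] [IsTopologicalGroup G] [CompactSpace G]
  [T2Space G] [MeasurableSpace G] [BorelSpace G]

variable (G) in
/-- The Hilbert space `L²(G)`. -/
abbrev HaarL2 : Type _ := Lp ℂ 2 (normalizedHaar G)

/-- Translation by `s` as an isometry of `L²(G)`. -/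
noncomputable def translationIsometry (s : G) : HaarL2 G →ₗᵢ[ℂ] HaarL2 G where
  toFun F := DomMulAct.mk s • F
  map_add' := DomMulAct.smul_Lp_add _
  map_smul' c F := smul_comm _ c F
  norm_map' := DomMulAct.norm_smul_Lp _

/-- Translation by `s` as a bounded operator on `L²(G)`. -/
noncomputable def translation (s : G) : HaarL2 G →L[ℂ] HaarL2 G :=
  (translationIsometry s).toContinuousLinearMap

lemma translation_apply (s : G) (F : HaarL2 G) : translation s F = DomMulAct.mk s • F := rfl

@[simp]
lemma norm_translation_apply (s : G) (F : HaarL2 G) : ‖translation s F‖ = ‖F‖ :=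
  (translationIsometry s).norm_map F

lemma translation_mul (s t : G) : translation (s * t) = translation s * translation t := by
  ext1 F
  rw [mul_apply_eq_comp, translation_apply, translation_apply, translation_apply,
    smul_smul, ← DomMulAct.mk_mul, mul_comm]

@[simp]
lemma translation_one : translation (1 : G) = 1 := by
  ext1 F
  rw [translation_apply, DomMulAct.mk_one, one_smul]
  rfl

lemma star_translation (s : G) : star (translation s) = translation s⁻¹ := by
  rw [ContinuousLinearMap.star_eq_adjoint]
  refine ((ContinuousLinearMap.eq_adjoint_iff _ _).2 fun x y => ?_).symm
  have h := (translationIsometry s).inner_map_map (translation s⁻¹ x) y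
  change inner ℂ (translation s (translation s⁻¹ x)) (translation s y) = _ at h
  rw [← h, ← mul_apply_eq_comp, ← translation_mul, mul_inv_cancel, translation_one]
  rfl

lemma continuous_translation_apply (F : HaarL2 G) : Continuous fun s : G => translation s F := by
  have : Fact ((2 : ENNReal) ≠ ⊤) := ⟨by simp⟩
  simp only [translation_apply]
  exact (DomMulAct.continuous_mk).smul continuous_const

lemma integrable_smul_translation (f : C(G, ℂ)) (F : HaarL2 G) :
    Integrable (fun s => f s • translation s F) (normalizedHaar G) :=
  (f.continuous.smul (continuous_translation_apply F)).integrable_of_hasCompactSupport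
    (HasCompactSupport.of_compactSpace _)

lemma norm_integral_smul_translation_le (f : C(G, ℂ)) (F : HaarL2 G) :
    ‖∫ s, f s • translation s F ∂(normalizedHaar G)‖ ≤ ‖f‖ * ‖F‖ := by
  refine (norm_integral_le_of_norm_le_const (C := ‖f‖ * ‖F‖)
    (Filter.Eventually.of_forall fun s => ?_)).trans (by simp)
  rw [norm_smul, norm_translation_apply]
  gcongr
  exact f.norm_coe_le_norm s

/-- The operator `∫ f(s) V(s) ds` on `L²(G)`, where `V` is the regular representation. -/
noncomputable def integratedTranslation (f : C(G, ℂ)) : HaarL2 G →L[ℂ] HaarL2 G :=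
  LinearMap.mkContinuous
    { toFun := fun F => ∫ s, f s • translation s F ∂(normalizedHaar G)
      map_add' := fun F H => by
        simp only [map_add, smul_add]
        exact integral_add (integrable_smul_translation f F) (integrable_smul_translation f H)
      map_smul' := fun c F => by
        simp only [map_smul, smul_comm _ c, integral_smul, RingHom.id_apply] }
    ‖f‖ (norm_integral_smul_translation_le f)

lemma integratedTranslation_apply (f : C(G, ℂ)) (F : HaarL2 G) :
    integratedTranslation f F = ∫ s, f s • translation s F ∂(normalizedHaar G) := rfl

lemma norm_integratedTranslation_le (f : C(G, ℂ)) : ‖integratedTranslation f‖ ≤ ‖f‖ :=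
  LinearMap.mkContinuous_norm_le _ (norm_nonneg f) _

lemma integratedTranslation_sub (f g : C(G, ℂ)) :
    integratedTranslation (f - g) = integratedTranslation f - integratedTranslation g := by
  ext1 F
  rw [sub_apply]
  simp only [integratedTranslation_apply, ContinuousMap.sub_apply, sub_smul]
  exact integral_sub (integrable_smul_translation f F) (integrable_smul_translation g F)

/-- The translate `x ↦ f (t * x)` of a continuous function. -/
noncomputable def translate (f : C(G, ℂ)) (t : G) : C(G, ℂ) := f.comp (ContinuousMap.mulLeft t)

@[simp]
lemma translate_apply (f : C(G, ℂ)) (t x : G) : translate f t x = f (t * x) := rfl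

lemma continuous_translate (f : C(G, ℂ)) : Continuous (translate f) :=
  ((f.comp (⟨fun p : G × G => p.1 * p.2, continuous_mul⟩ : C(G × G, G))).curry).continuous

lemma translation_mul_integratedTranslation (t : G) (f : C(G, ℂ)) :
    translation t * integratedTranslation f = integratedTranslation (translate f t⁻¹) := by
  ext1 F
  rw [mul_apply_eq_comp, integratedTranslation_apply, integratedTranslation_apply,
    ← ContinuousLinearMap.integral_comp_comm _ (integrable_smul_translation f F),
    ← integral_mul_left_eq_self (fun s => translate f t⁻¹ s • translation s F) t]
  refine integral_congr_ae (Filter.Eventually.of_forall fun s => ?_)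
  simp only [map_smul, translate_apply, inv_mul_cancel_left, translation_mul,
    mul_apply_eq_comp]

/-- Translations are shown only to be strongly continuous. Multiplied by a smoothing operator they
become norm continuous, which later makes the characters produced by Gelfand theory continuous. -/
lemma continuous_translation_mul_integratedTranslation (f : C(G, ℂ)) :
    Continuous fun t : G => translation t * integratedTranslation f := by
  simp only [translation_mul_integratedTranslation]
  have h : Continuous fun f : C(G, ℂ) => integratedTranslation f := by
    refine LipschitzWith.continuous (K := 1) (LipschitzWith.of_dist_le_mul fun f g => ?_)
    rw [dist_eq_norm, dist_eq_norm, ← integratedTranslation_sub, NNReal.coe_one, one_mul]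
    exact norm_integratedTranslation_le _
  exact h.comp ((continuous_translate f).comp continuous_inv)

lemma commute_integratedTranslation {A : HaarL2 G →L[ℂ] HaarL2 G}
    (hA : ∀ s, translation s * A = A * translation s) (f : C(G, ℂ)) :
    A * integratedTranslation f = integratedTranslation f * A := by
  ext1 F
  rw [mul_apply_eq_comp, mul_apply_eq_comp, integratedTranslation_apply,
    integratedTranslation_apply,
    ← ContinuousLinearMap.integral_comp_comm _ (integrable_smul_translation f F)]
  refine integral_congr_ae (Filter.Eventually.of_forall fun s => ?_)
  have h : translation s (A F) = A (translation s F) := congrArg (· F) (hA s)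
  simp only [map_smul, h]

/-- A nontrivial group element is not killed by the regular representation of `C(G)`. -/
lemma exists_translation_mul_integratedTranslation_ne {g : G} (hg : g ≠ 1) :
    ∃ f : C(G, ℂ), translation g * integratedTranslation f ≠ integratedTranslation f := by
  by_contra! hall
  -- The continuous map `s ↦ V(g)V(s)F - V(s)F` integrates to zero against every `f`. Testing with
  -- the conjugate of its inner product with `w` gives `∫ ‖c‖² = 0`, so the map vanishes, in
  -- particular at `s = 1`.
  have hfix (F : HaarL2 G) : translation g F = F := by
    have hW : Continuous fun s : G => translation g (translation s F) - translation s F :=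
      ((translation g).continuous.comp (continuous_translation_apply F)).sub
        (continuous_translation_apply F)
    have hzero (w : HaarL2 G) :
        inner ℂ w (translation g (translation 1 F) - translation 1 F) = 0 := by
      let c : C(G, ℂ) :=
        ⟨fun s => inner ℂ w (translation g (translation s F) - translation s F),
          continuous_const.inner hW⟩
      have h1 : ∫ s, star (c s) • (translation g (translation s F) - translation s F)
          ∂(normalizedHaar G) = 0 := by
        have h2 : translation g (integratedTranslation (star c) F) =
          integratedTranslation (star c) F := congrArg (· F) (hall (star c))
        rw [integratedTranslation_apply,
          ← ContinuousLinearMap.integral_comp_comm _ (integrable_smul_translation _ F),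
          ← sub_eq_zero, ← integral_sub ((translation g).integrable_comp
            (integrable_smul_translation _ F)) (integrable_smul_translation _ F)] at h2
        rw [← h2]
        refine integral_congr_ae (Filter.Eventually.of_forall fun s => ?_)
        simp only [map_smul, smul_sub, ContinuousMap.star_apply]
      have h3 : ∫ s, ‖c s‖ ^ 2 ∂(normalizedHaar G) = 0 := by
        have h4 := congrArg (fun v => (innerSL ℂ w) v) h1
        simp only [map_zero] at h4
        have hint : Integrable (fun s => star (c s) •
            (translation g (translation s F) - translation s F)) (normalizedHaar G) :=
          (c.continuous.star.smul hW).integrable_of_hasCompactSupport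
            (HasCompactSupport.of_compactSpace _)
        rw [← ContinuousLinearMap.integral_comp_comm _ hint] at h4
        have h5 : ∫ s, ((‖c s‖ ^ 2 : ℝ) : ℂ) ∂(normalizedHaar G) = 0 := by
          rw [← h4]
          refine integral_congr_ae (Filter.Eventually.of_forall fun s => ?_)
          simp only [map_smul, innerSL_apply_apply, smul_eq_mul]
          change _ = conj (c s) * c s
          rw [← Complex.normSq_eq_conj_mul_self, Complex.normSq_eq_norm_sq]
        rw [integral_complex_ofReal] at h5
        exact_mod_cast h5
      have h6 := (integral_eq_zero_iff_of_nonneg (fun s => sq_nonneg ‖c s‖)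
        ((c.continuous.norm.pow 2).integrable_of_hasCompactSupport
          (HasCompactSupport.of_compactSpace _))).1 h3
      have h7 := congrFun ((c.continuous.norm.pow 2).ae_eq_iff_eq _ continuous_const |>.1 h6) 1
      exact norm_eq_zero.1 (pow_eq_zero_iff two_ne_zero |>.1 h7)
    have := hzero (translation g (translation 1 F) - translation 1 F)
    rw [inner_self_eq_zero, sub_eq_zero] at this
    simpa using this
  -- A Urysohn function separating `g` from `1` is moved by `V(g)`.
  obtain ⟨h, h0, h1, -⟩ := exists_continuous_zero_one_of_isClosed (isClosed_singleton (x := g))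
    (isClosed_singleton (x := (1 : G))) (by simpa using hg)
  have hc : Continuous fun x => (h x : ℂ) := Complex.continuous_ofReal.comp h.continuous
  have hm : MemLp (fun x => (h x : ℂ)) 2 (normalizedHaar G) :=
    hc.memLp_of_hasCompactSupport (HasCompactSupport.of_compactSpace _)
  have h2 := hfix (hm.toLp _)
  rw [translation_apply, DomMulAct.mk_smul_toLp, MemLp.toLp_eq_toLp_iff] at h2
  have hc' : Continuous fun x : G => (h (g • x) : ℂ) := hc.comp (continuous_const_smul g)
  have h3 := congrFun ((hc'.ae_eq_iff_eq _ hc).1 h2) 1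
  have h4 : h g = 0 := h0 rfl
  have h5 : h 1 = 1 := h1 rfl
  simp [h4, h5] at h3

/-! ### Characters of the group from characters of an operator algebra. -/

variable (G) in
/-- The von Neumann algebra generated by the translations of `L²(G)`. -/
noncomputable def translationAlgebra : StarSubalgebra ℂ (HaarL2 G →L[ℂ] HaarL2 G) :=
  StarSubalgebra.centralizer ℂ
    (StarSubalgebra.centralizer ℂ (Set.range (translation (G := G))) : Set _)

lemma star_range_translation :
    Set.range (translation (G := G)) ∪ star (Set.range (translation (G := G))) =
      Set.range (translation (G := G)) := by
  refine Set.union_eq_self_of_subset_right ?_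
  rintro A ⟨s, hs⟩
  exact ⟨s⁻¹, by rw [← star_translation, hs, star_star]⟩

lemma mem_translationAlgebra_iff {A : HaarL2 G →L[ℂ] HaarL2 G} :
    A ∈ translationAlgebra G ↔
      ∀ B : HaarL2 G →L[ℂ] HaarL2 G, (∀ s, translation s * B = B * translation s) →
        B * A = A * B := by
  rw [← SetLike.mem_coe, translationAlgebra, StarSubalgebra.coe_centralizer_centralizer,
    star_range_translation, Set.mem_centralizer_iff]
  simp only [Set.mem_centralizer_iff, Set.forall_mem_range]

instance : IsClosed (translationAlgebra G : Set (HaarL2 G →L[ℂ] HaarL2 G)) :=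
  Set.isClosed_centralizer _

lemma translation_comm (s t : G) : translation s * translation t = translation t * translation s := by
  rw [← translation_mul, mul_comm, translation_mul]

lemma translation_mem (s : G) : translation s ∈ translationAlgebra G :=
  mem_translationAlgebra_iff.2 fun _ hB => (hB s).symm

lemma integratedTranslation_mem (f : C(G, ℂ)) :
    integratedTranslation f ∈ translationAlgebra G :=
  mem_translationAlgebra_iff.2 fun _ hB => commute_integratedTranslation hB f

/-- Translations commute with each other, so they commute with the bicommutant; hence the
bicommutant lies in its own commutant. -/
lemma translationAlgebra_comm (A B : translationAlgebra G) : A * B = B * A := by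
  refine Subtype.ext (mem_translationAlgebra_iff.1 B.2 A fun s => ?_)
  exact mem_translationAlgebra_iff.1 A.2 _ fun t => translation_comm t s

noncomputable instance : CommCStarAlgebra (translationAlgebra G) :=
  { StarSubalgebra.cstarAlgebra (translationAlgebra G) with
    mul_comm := translationAlgebra_comm }

open WeakDual in
/-- The characters of a compact abelian group separate points. -/
theorem exists_character_ne_one {g : G} (hg : g ≠ 1) : ∃ γ : PontryaginDual G, γ g ≠ 1 := by
  obtain ⟨f, hf⟩ := exists_translation_mul_integratedTranslation_ne hg
  let V (s : G) : translationAlgebra G := ⟨translation s, translation_mem s⟩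
  let T : translationAlgebra G := ⟨integratedTranslation f, integratedTranslation_mem f⟩
  have hVT : V g * T - T ≠ 0 := fun h => hf (congrArg Subtype.val (sub_eq_zero.1 h))
  -- The Gelfand transform is injective, so some `χ` does not kill `V g * T - T`. This forces `χ T ≠
  -- 0` and `χ (V g) ≠ 1`, and `χ ∘ V` is the desired character.
  obtain ⟨χ, hχ⟩ : ∃ χ : characterSpace ℂ (translationAlgebra G), χ (V g * T - T) ≠ 0 := by
    by_contra! h
    refine hVT ((gelfandTransform_isometry (translationAlgebra G)).injective ?_)
    ext χ
    simpa using h χ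
  have hmul : χ (V g) * χ T - χ T ≠ 0 := by rwa [← map_mul, ← map_sub]
  have hT : χ T ≠ 0 := fun h => hmul (by rw [h]; ring)
  have hV (s t : G) : χ (V (s * t)) = χ (V s) * χ (V t) := by
    rw [← map_mul]
    exact congrArg χ (Subtype.ext (translation_mul s t))
  have hV1 : χ (V 1) = 1 := by
    rw [← map_one χ]
    exact congrArg χ (Subtype.ext translation_one)
  have hnorm (s : G) : ‖χ (V s)‖ = 1 := by
    have h1 : star (V s) = V s⁻¹ := Subtype.ext (star_translation s)
    have h2 : star (χ (V s)) * χ (V s) = 1 := by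
      rw [← map_star, h1, ← hV, inv_mul_cancel, hV1]
    have h3 := congrArg norm h2
    rw [norm_mul, norm_star, norm_one] at h3
    nlinarith [norm_nonneg (χ (V s))]
  have hcont : Continuous fun s => χ (V s) := by
    have h1 : Continuous fun s => V s * T :=
      (continuous_translation_mul_integratedTranslation f).subtype_mk _
    have h2 : Continuous fun s => χ (V s * T) := (map_continuous χ).comp h1
    have h3 : (fun s => χ (V s)) = fun s => χ (V s * T) * (χ T)⁻¹ := by
      ext s
      rw [map_mul, mul_inv_cancel_right₀ hT]
    rw [h3]
    exact h2.mul continuous_const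
  let γ : G →ₜ* Circle :=
    { toFun := fun s => ⟨χ (V s), mem_sphere_zero_iff_norm.2 (hnorm s)⟩
      map_one' := Subtype.ext hV1
      map_mul' := fun s t => Subtype.ext (hV s t)
      continuous_toFun := hcont.subtype_mk _ }
  refine ⟨γ, fun h => hmul ?_⟩
  have h1 : χ (V g) = 1 := congrArg Subtype.val h
  rw [h1, one_mul, sub_self]

/-! ### Trigonometric polynomials and uniqueness of Fourier coefficients. -/

/-- A character as a continuous function. -/
noncomputable def charFun (γ : PontryaginDual G) : C(G, ℂ) :=
  ⟨fun x => (γ x : ℂ), continuous_subtype_val.comp (map_continuous γ)⟩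

@[simp]
lemma charFun_apply (γ : PontryaginDual G) (x : G) : charFun γ x = (γ x : ℂ) := rfl

lemma charFun_mul (γ δ : PontryaginDual G) : charFun (γ * δ) = charFun γ * charFun δ := rfl

lemma charFun_inv_apply (γ : PontryaginDual G) (x : G) : charFun γ⁻¹ x = conj (γ x : ℂ) := by
  rw [charFun_apply]
  exact Circle.coe_inv_eq_conj (γ x)

variable (G) in
/-- The star algebra of trigonometric polynomials. -/
noncomputable def trigPolynomials : StarSubalgebra ℂ C(G, ℂ) where
  carrier := Submodule.span ℂ (Set.range (charFun (G := G)))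
  zero_mem' := Submodule.zero_mem _
  add_mem' := Submodule.add_mem _
  mul_mem' := by
    intro a b ha hb
    have h := Submodule.mul_mem_mul ha hb
    rw [Submodule.span_mul_span] at h
    refine Submodule.span_mono ?_ h
    rintro _ ⟨_, ⟨γ, rfl⟩, _, ⟨δ, rfl⟩, rfl⟩
    exact ⟨γ * δ, charFun_mul γ δ⟩
  algebraMap_mem' := by
    intro c
    have h : algebraMap ℂ C(G, ℂ) c = c • charFun 1 := by
      ext x
      simp
    rw [h]
    exact Submodule.smul_mem _ _ (Submodule.subset_span ⟨1, rfl⟩)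
  star_mem' := by
    intro a ha
    induction ha using Submodule.span_induction with
    | mem x hx =>
      obtain ⟨γ, rfl⟩ := hx
      refine Submodule.subset_span ⟨γ⁻¹, ?_⟩
      ext x
      rw [charFun_inv_apply]
      rfl
    | zero => simp
    | add x y _ _ hx hy => rw [star_add]; exact Submodule.add_mem _ hx hy
    | smul c x _ hx => rw [star_smul]; exact Submodule.smul_mem _ _ hx

lemma topologicalClosure_trigPolynomials : (trigPolynomials G).topologicalClosure = ⊤ := by
  refine ContinuousMap.starSubalgebra_topologicalClosure_eq_top_of_separatesPoints _ ?_
  intro x y hxy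
  obtain ⟨γ, hγ⟩ := exists_character_ne_one (g := x * y⁻¹) (by rwa [ne_eq, mul_inv_eq_one])
  refine ⟨_, ⟨charFun γ, Submodule.subset_span ⟨γ, rfl⟩, rfl⟩, fun h => hγ ?_⟩
  rw [map_mul, map_inv, mul_inv_eq_one]
  exact Subtype.ext h

/-- A continuous function all of whose Fourier coefficients vanish is zero. -/
theorem eq_zero_of_fourierCoefficient_eq_zero {h : C(G, ℂ)}
    (hh : ∀ γ, fourierCoefficient h γ = 0) : h = 0 := by
  -- Integration against `h` kills all trigonometric polynomials, hence by density everything,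
  -- including `star h`.
  let L : C(G, ℂ) →L[ℂ] ℂ := LinearMap.mkContinuous
    { toFun := fun f => ∫ x, f x * h x ∂(normalizedHaar G)
      map_add' := fun f g => by
        simp only [ContinuousMap.add_apply, add_mul]
        exact integral_add (integrable_continuousMap _ (f * h)) (integrable_continuousMap _ (g * h))
      map_smul' := fun c f => by
        simp only [ContinuousMap.smul_apply, smul_eq_mul, mul_assoc, RingHom.id_apply]
        exact integral_const_mul c _ }
    ‖h‖ fun f => by
      refine (norm_integral_le_of_norm_le_const (C := ‖h‖ * ‖f‖)
        (Filter.Eventually.of_forall fun s => ?_)).trans (by simp)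
      rw [norm_mul, mul_comm]
      gcongr
      · exact h.norm_coe_le_norm s
      · exact f.norm_coe_le_norm s
  have hspan : ∀ f ∈ trigPolynomials G, L f = 0 := by
    intro f hf
    have hle : Submodule.span ℂ (Set.range (charFun (G := G))) ≤ LinearMap.ker L.toLinearMap := by
      refine Submodule.span_le.2 ?_
      rintro _ ⟨γ, rfl⟩
      change ∫ x, charFun γ x * h x ∂(normalizedHaar G) = 0
      rw [← hh γ⁻¹]
      refine integral_congr_ae (Filter.Eventually.of_forall fun x => ?_)
      change _ = conj (charFun γ⁻¹ x) * h x
      rw [charFun_inv_apply, Complex.conj_conj]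
      rfl
    exact hle hf
  have hall (f : C(G, ℂ)) : L f = 0 := by
    have hf : f ∈ closure (trigPolynomials G : Set C(G, ℂ)) := by
      rw [← StarSubalgebra.topologicalClosure_coe, topologicalClosure_trigPolynomials]
      trivial
    exact closure_minimal (s := (trigPolynomials G : Set C(G, ℂ))) hspan
      (isClosed_eq L.continuous continuous_const) hf
  have h1 : ∫ x, ((‖h x‖ ^ 2 : ℝ) : ℂ) ∂(normalizedHaar G) = 0 := by
    rw [← hall (star h)]
    refine integral_congr_ae (Filter.Eventually.of_forall fun s => ?_)
    change _ = conj (h s) * h s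
    rw [← Complex.normSq_eq_conj_mul_self, Complex.normSq_eq_norm_sq]
  rw [integral_complex_ofReal] at h1
  have h2 := (integral_eq_zero_iff_of_nonneg (fun s => sq_nonneg ‖h s‖)
    ((h.continuous.norm.pow 2).integrable_of_hasCompactSupport
      (HasCompactSupport.of_compactSpace _))).1 (by exact_mod_cast h1)
  have h3 := (h.continuous.norm.pow 2).ae_eq_iff_eq _ continuous_const |>.1 h2
  ext x
  exact norm_eq_zero.1 (pow_eq_zero_iff two_ne_zero |>.1 (congrFun h3 x))

lemma fourierCoefficient_translate (f : C(G, ℂ)) (t : G) (γ : PontryaginDual G) :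
    fourierCoefficient (translate f t) γ = (γ t : ℂ) * fourierCoefficient f γ := by
  rw [fourierCoefficient, fourierCoefficient, ← integral_const_mul,
    ← integral_mul_left_eq_self (fun x => (γ t : ℂ) * (conj (γ x : ℂ) * f x)) t]
  refine integral_congr_ae (Filter.Eventually.of_forall fun x => ?_)
  have h : (γ t : ℂ) * conj (γ t : ℂ) = 1 := by
    rw [Complex.mul_conj, Circle.normSq_coe, Complex.ofReal_one]
  simp only [translate_apply, map_mul, Circle.coe_mul]
  linear_combination (-(conj (γ x : ℂ)) * f (t * x)) * h

lemma translate_mem_continuousWithSpec {Λ : Set (PontryaginDual G)} {f : C(G, ℂ)}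
    (hf : f ∈ continuousWithSpec Λ) (t : G) : translate f t ∈ continuousWithSpec Λ := by
  intro γ hγ
  refine hf fun h => hγ ?_
  rw [fourierCoefficient_translate, h, mul_zero]

/-- A functional on `C(G)` that vanishes at the characters in `Λ` vanishes on `C_Λ(G)`. -/
theorem functional_eq_zero_of_mem_continuousWithSpec {Λ : Set (PontryaginDual G)}
    (ψ : C(G, ℂ) →L[ℂ] ℂ) (hψ : ∀ γ ∈ Λ, ψ (charFun γ) = 0) {f : C(G, ℂ)}
    (hf : f ∈ continuousWithSpec Λ) : ψ f = 0 := by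
  -- The coefficient of `t ↦ ψ (translate f t)` at `γ` is that of `f` times `ψ (charFun γ)`; one
  -- factor vanishes whether or not `γ ∈ Λ`. So the function is zero, and `t = 1` gives the claim.
  let h : C(G, ℂ) := ⟨fun t => ψ (translate f t), ψ.continuous.comp (continuous_translate f)⟩
  have hzero : h = 0 := by
    refine eq_zero_of_fourierCoefficient_eq_zero fun γ => ?_
    have hint : Integrable (fun t => conj (γ t : ℂ) • translate f t) (normalizedHaar G) :=
      ((Complex.continuous_conj.comp (charFun γ).continuous).smul
        (continuous_translate f)).integrable_of_hasCompactSupport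
          (HasCompactSupport.of_compactSpace _)
    have h1 : fourierCoefficient h γ =
        ψ (∫ t, conj (γ t : ℂ) • translate f t ∂(normalizedHaar G)) := by
      rw [← ContinuousLinearMap.integral_comp_comm _ hint]
      refine integral_congr_ae (Filter.Eventually.of_forall fun t => ?_)
      simp only [map_smul, smul_eq_mul]
      rfl
    have h2 : ∫ t, conj (γ t : ℂ) • translate f t ∂(normalizedHaar G) =
        fourierCoefficient f γ • charFun γ := by
      ext x
      have h3 := (ContinuousLinearMap.integral_comp_comm
        (ContinuousMap.evalCLM ℂ x) hint).symm
      refine h3.trans ?_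
      change ∫ t, conj (γ t : ℂ) * f (t * x) ∂(normalizedHaar G) =
        fourierCoefficient f γ * (γ x : ℂ)
      rw [mul_comm, ← fourierCoefficient_translate]
      refine integral_congr_ae (Filter.Eventually.of_forall fun t => ?_)
      simp only [translate_apply, mul_comm]
    rw [h1, h2, map_smul, smul_eq_mul]
    by_cases hγ : γ ∈ Λ
    · rw [hψ γ hγ, mul_zero]
    · have : fourierCoefficient f γ = 0 := by_contra fun h => hγ (hf h)
      rw [this, zero_mul]
  have h4 : ψ (translate f 1) = 0 := congrArg (fun k : C(G, ℂ) => k 1) hzero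
  have h5 : translate f 1 = f := by
    ext x
    simp
  rwa [h5] at h4

end Regular

/-! ### Narrow operators on spaces of continuous functions -/

/-- The radial retraction of the complex plane onto the unit disc. -/
noncomputable def discRetraction (w : ℂ) : ℂ := w / (max 1 ‖w‖ : ℝ)

lemma continuous_discRetraction : Continuous discRetraction := by
  refine continuous_id.div (by fun_prop) fun w => ?_
  have : (0 : ℝ) < max 1 ‖w‖ := lt_max_of_lt_left one_pos
  exact_mod_cast this.ne'

lemma norm_discRetraction_le (w : ℂ) : ‖discRetraction w‖ ≤ 1 := by
  have h : (0 : ℝ) < max 1 ‖w‖ := lt_max_of_lt_left one_pos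
  rw [discRetraction, norm_div, Complex.norm_real, Real.norm_of_nonneg h.le, div_le_one h]
  exact le_max_right _ _

lemma discRetraction_of_norm_le {w : ℂ} (hw : ‖w‖ ≤ 1) : discRetraction w = w := by
  simp [discRetraction, max_eq_left hw]

section Compact

variable {K : Type*} [TopologicalSpace K] [CompactSpace K] [T2Space K]

lemma exists_bump {U : Set K} (hU : IsOpen U) {t : K} (ht : t ∈ U) :
    ∃ x : C(K, ℝ), x t = 1 ∧ (∀ s ∉ U, x s = 0) ∧ ∀ s, x s ∈ Set.Icc (0 : ℝ) 1 := by
  obtain ⟨x, h0, h1, h⟩ := exists_continuous_zero_one_of_isClosed hU.isClosed_compl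
    (isClosed_singleton (x := t)) (by simpa using ht)
  exact ⟨x, h1 rfl, fun s hs => h0 hs, h⟩

lemma exists_norm_eq [Nonempty K] (x : C(K, ℂ)) : ∃ t, ‖x t‖ = ‖x‖ := by
  obtain ⟨t, -, ht⟩ := isCompact_univ.exists_isMaxOn Set.univ_nonempty
    x.continuous.norm.continuousOn
  exact ⟨t, le_antisymm (x.norm_coe_le_norm t)
    ((ContinuousMap.norm_le _ (norm_nonneg _)).2 fun s => ht (Set.mem_univ s))⟩

variable {E : Type*} [SeminormedAddCommGroup E] [NormedSpace ℂ E]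

/-- The growth step: a function that is bounded by one off `U` can be increased at a point of `U`
by adding a function that is almost in the kernel of a narrow operator. -/
lemma IsNarrow.exists_increment {T : C(K, ℂ) →L[ℂ] E} (hT : IsNarrow T) {U : Set K}
    (hU : IsOpen U) {S : C(K, ℂ)} (hS : ∀ s ∉ U, ‖S s‖ ≤ 1) {t : K} (ht : t ∈ U) {η : ℝ}
    (hη : 0 < η) :
    ∃ S' : C(K, ℂ), ∃ t' ∈ U, (∀ s ∉ U, ‖S' s‖ ≤ 1) ∧ ‖S'‖ ≤ ‖S‖ + 2 ∧
      (S t).re + 1 / 2 ≤ (S' t').re ∧ ‖T S'‖ ≤ ‖T S‖ + η := by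
  have : Nonempty K := ⟨t⟩
  have hV : IsOpen (U ∩ {s | (S t).re - 1 / 2 < (S s).re}) :=
    hU.inter (isOpen_lt continuous_const (by fun_prop))
  obtain ⟨b, hbt, hb0, hb⟩ := exists_bump hV (t := t) ⟨ht, by simp⟩
  let x : C(K, ℂ) := ⟨fun s => (b s : ℂ), by fun_prop⟩
  -- `y` equals `S` off `U` and `-1` at `t`. Where `‖x + z‖` is attained, `z` has real part at least
  -- `1/2` and `y` at most `-1/2`; thus `S - (y - z)` gains `1` there, less the `1/2` lost by moving
  -- from `t` to `t'`. Off `U` it is just `z`.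
  let y : C(K, ℂ) := ⟨fun s => (1 - (b s : ℂ)) * discRetraction (S s) - (b s : ℂ), by
    have := continuous_discRetraction.comp S.continuous
    fun_prop⟩
  have hx1 (s : K) : ‖x s‖ ≤ 1 := by
    change ‖(b s : ℂ)‖ ≤ 1
    rw [Complex.norm_real, Real.norm_of_nonneg (hb s).1]
    exact (hb s).2
  have hb' (s : K) : ‖(1 - (b s : ℂ)) * discRetraction (S s)‖ ≤ 1 - b s := by
    have h1 : ‖1 - (b s : ℂ)‖ = 1 - b s := by
      rw [← Complex.ofReal_one, ← Complex.ofReal_sub, Complex.norm_real,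
        Real.norm_of_nonneg (sub_nonneg.2 (hb s).2)]
    rw [norm_mul, h1]
    exact mul_le_of_le_one_right (sub_nonneg.2 (hb s).2) (norm_discRetraction_le _)
  have hy1 (s : K) : ‖y s‖ ≤ 1 := by
    refine (norm_sub_le _ _).trans ?_
    rw [Complex.norm_real, Real.norm_of_nonneg (hb s).1]
    linarith [hb' s]
  have hxn : ‖x‖ = 1 := by
    refine le_antisymm ((ContinuousMap.norm_le _ zero_le_one).2 hx1) ?_
    refine le_trans (le_of_eq ?_) (x.norm_coe_le_norm t)
    change 1 = ‖(b t : ℂ)‖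
    simp [hbt]
  have hyn : ‖y‖ = 1 := by
    refine le_antisymm ((ContinuousMap.norm_le _ zero_le_one).2 hy1) ?_
    refine le_trans (le_of_eq ?_) (y.norm_coe_le_norm t)
    change 1 = ‖(1 - (b t : ℂ)) * discRetraction (S t) - (b t : ℂ)‖
    simp [hbt]
  obtain ⟨z, hz, hTz, hxz⟩ := hT x (mem_sphere_zero_iff_norm.2 hxn) y
    (mem_sphere_zero_iff_norm.2 hyn) 0 (min η (1 / 4)) (by positivity)
  have hz1 (s : K) : ‖z s‖ ≤ 1 := (z.norm_coe_le_norm s).trans (mem_sphere_zero_iff_norm.1 hz).le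
  obtain ⟨t', ht'⟩ := exists_norm_eq (x + z)
  have hsum : 7 / 4 ≤ ‖(b t' : ℂ) + z t'‖ := by
    have h1 : 2 - min η (1 / 4) ≤ ‖(b t' : ℂ) + z t'‖ := hxz.trans ht'.ge
    linarith [min_le_right η (1 / 4)]
  have hbt' : 3 / 4 ≤ b t' := by
    have h1 := hsum.trans (norm_add_le _ _)
    rw [Complex.norm_real, Real.norm_of_nonneg (hb t').1] at h1
    linarith [hz1 t']
  have hzre : 1 / 2 ≤ (z t').re := by
    have h1 : ‖(b t' : ℂ) + z t'‖ ^ 2 = b t' ^ 2 + 2 * b t' * (z t').re + ‖z t'‖ ^ 2 := by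
      rw [Complex.sq_norm, Complex.sq_norm, Complex.normSq_apply, Complex.normSq_apply]
      simp
      ring
    have h2 : (7 / 4 : ℝ) ^ 2 ≤ ‖(b t' : ℂ) + z t'‖ ^ 2 := by gcongr
    have h3 : ‖z t'‖ ^ 2 ≤ 1 := pow_le_one₀ (norm_nonneg _) (hz1 t')
    have h4 : b t' ^ 2 ≤ 1 := pow_le_one₀ (hb t').1 (hb t').2
    by_contra! h5
    nlinarith [(hb t').2]
  have hyre : (y t').re ≤ -(1 / 2) := by
    have h1 : (y t').re = ((1 - (b t' : ℂ)) * discRetraction (S t')).re - b t' := by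
      change ((1 - (b t' : ℂ)) * discRetraction (S t') - (b t' : ℂ)).re = _
      rw [Complex.sub_re, Complex.ofReal_re]
    linarith [(Complex.re_le_norm _).trans (hb' t')]
  have ht'V : t' ∈ U ∩ {s | (S t).re - 1 / 2 < (S s).re} := by
    by_contra h
    linarith [hb0 t' h]
  refine ⟨S - (y - z), t', ht'V.1, fun s hs => ?_, ?_, ?_, ?_⟩
  · have hbs : b s = 0 := hb0 s fun h => hs h.1
    have h1 : y s = S s := by
      change (1 - (b s : ℂ)) * discRetraction (S s) - (b s : ℂ) = S s
      rw [hbs, discRetraction_of_norm_le (hS s hs)]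
      simp
    rw [ContinuousMap.sub_apply, ContinuousMap.sub_apply, h1, sub_sub_cancel]
    exact hz1 s
  · refine (norm_sub_le _ _).trans (add_le_add_right ?_ _)
    refine (norm_sub_le _ _).trans ?_
    rw [hyn, mem_sphere_zero_iff_norm.1 hz]
    norm_num
  · have h1 : (S t).re - 1 / 2 < (S t').re := ht'V.2
    simp only [ContinuousMap.sub_apply, Complex.sub_re]
    linarith
  · rw [map_sub]
    refine (norm_sub_le _ _).trans (add_le_add_right ?_ _)
    have h1 : 0 ≤ ‖(0 : C(K, ℂ) →L[ℂ] ℂ) (y - z)‖ := norm_nonneg _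
    linarith [min_le_left η (1 / 4)]

/-- A narrow operator is almost zero at some functions that peak inside a given open set. -/
lemma IsNarrow.exists_peak {T : C(K, ℂ) →L[ℂ] E} (hT : IsNarrow T) {U : Set K}
    (hU : IsOpen U) (hne : U.Nonempty) {δ : ℝ} (hδ : 0 < δ) :
    ∃ f : C(K, ℂ), ∃ t ∈ U, f t = 1 ∧ ‖f‖ ≤ 6 ∧ (∀ s ∉ U, ‖f s‖ ≤ δ) ∧ ‖T f‖ ≤ δ := by
  obtain ⟨t₀, ht₀⟩ := hne
  have key (n : ℕ) : ∃ S : C(K, ℂ), ∃ t ∈ U, (∀ s ∉ U, ‖S s‖ ≤ 1) ∧ ‖S‖ ≤ 2 * n ∧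
      (n : ℝ) / 2 ≤ (S t).re ∧ ‖T S‖ ≤ n * (δ / 2) := by
    induction n with
    | zero => exact ⟨0, t₀, ht₀, by simp⟩
    | succ n ih =>
      obtain ⟨S, t, ht, hS1, hSn, hSt, hTS⟩ := ih
      obtain ⟨S', t', ht', h1, h2, h3, h4⟩ := hT.exists_increment hU hS1 ht (half_pos hδ)
      refine ⟨S', t', ht', h1, ?_, ?_, ?_⟩ <;> push_cast <;> linarith
  -- After `n` steps the peak is at least `n / 2` while the values off `U` are at most `1`; division
  -- by the peak leaves at most `2 / n < δ` there.
  obtain ⟨n, hn⟩ := exists_nat_gt (max 1 (2 / δ))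
  have hn1 : (1 : ℝ) < n := (le_max_left _ _).trans_lt hn
  have hnδ : 2 / δ < n := (le_max_right _ _).trans_lt hn
  obtain ⟨S, t, ht, h1, h2, h3, h4⟩ := key n
  have hSt : (n : ℝ) / 2 ≤ ‖S t‖ := h3.trans (Complex.re_le_norm _)
  have hpos : 0 < ‖S t‖ := lt_of_lt_of_le (by positivity) hSt
  have hinv : ‖(S t)⁻¹‖ ≤ 2 / n := by
    rw [norm_inv, inv_le_comm₀ hpos (by positivity), inv_div]
    exact hSt
  have hn0 : (0 : ℝ) < n := one_pos.trans hn1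
  refine ⟨(S t)⁻¹ • S, t, ht, ?_, ?_, fun s hs => ?_, ?_⟩
  · rw [ContinuousMap.smul_apply, smul_eq_mul, inv_mul_cancel₀ (norm_pos_iff.1 hpos)]
  · rw [norm_smul]
    calc ‖(S t)⁻¹‖ * ‖S‖ ≤ 2 / n * (2 * n) := by gcongr
      _ ≤ 6 := by field_simp; norm_num
  · rw [ContinuousMap.smul_apply, norm_smul]
    calc ‖(S t)⁻¹‖ * ‖S s‖ ≤ 2 / n * 1 := by gcongr; exact h1 s hs
      _ ≤ δ := by
        rw [mul_one, div_le_iff₀ hn0]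
        rw [div_lt_iff₀ hδ] at hnδ
        linarith
  · rw [map_smul, norm_smul]
    calc ‖(S t)⁻¹‖ * ‖T S‖ ≤ 2 / n * (n * (δ / 2)) := by gcongr
      _ ≤ δ := by field_simp; rfl

/-- An operator is narrow if together with any functional it is almost zero at some bump
functions inside any given open set. -/
lemma isNarrow_of_exists_bump [Nonempty K] {T : C(K, ℂ) →L[ℂ] E}
    (h : ∀ U : Set K, IsOpen U → U.Nonempty → ∀ φ : C(K, ℂ) →L[ℂ] ℂ, ∀ δ : ℝ, 0 < δ →
      ∃ f : C(K, ℝ), ∃ t ∈ U, f t = 1 ∧ (∀ s ∉ U, f s = 0) ∧ (∀ s, f s ∈ Set.Icc (0 : ℝ) 1) ∧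
        ‖T (Complex.ofRealCLM.compLeftContinuous ℝ K f)‖ ≤ δ ∧
        ‖φ (Complex.ofRealCLM.compLeftContinuous ℝ K f)‖ ≤ δ) : IsNarrow T := by
  intro x hx y hy φ ε hε
  rw [mem_sphere_zero_iff_norm] at hx hy
  obtain ⟨t₀, ht₀⟩ := exists_norm_eq x
  rw [hx] at ht₀
  -- The `7 * δ` is the loss in `‖x + z‖`; it also covers the `4 * δ` from `T` and `φ` on the bump,
  -- and the other terms come from normalizing `z₀`.
  let C : ℝ := 7 + 3 * ‖T‖ + 3 * ‖φ‖
  have hC : 0 < C := by positivity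
  let δ : ℝ := min (1 / 6) (ε / C)
  have hδ : 0 < δ := by positivity
  have hδ6 : δ ≤ 1 / 6 := min_le_left _ _
  have hδC : C * δ ≤ ε := by
    have := min_le_right (1 / 6) (ε / C)
    rwa [le_div_iff₀ hC, mul_comm] at this
  have hU : IsOpen ({s | ‖x s - x t₀‖ < δ} ∩ {s | ‖y s - y t₀‖ < δ}) :=
    (isOpen_lt (by fun_prop) continuous_const).inter (isOpen_lt (by fun_prop) continuous_const)
  obtain ⟨f, t, ⟨htx, hty⟩, hft, hf0, hf, hTf, hφf⟩ := h _ hU ⟨t₀, by simp [hδ]⟩ φ δ hδ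
  let F : C(K, ℂ) := Complex.ofRealCLM.compLeftContinuous ℝ K f
  have hF (s : K) : F s = (f s : ℂ) := rfl
  let c : ℂ := x t₀ - y t₀
  have hc : ‖c‖ ≤ 2 := by
    refine (norm_sub_le _ _).trans ?_
    linarith [y.norm_coe_le_norm t₀]
  -- On the neighbourhood `z₀` is nearly a convex combination of `y` and the constant `x t₀`, so its
  -- norm hardly exceeds `1`, while at `t` it nearly equals `x`.
  let z₀ : C(K, ℂ) := y + c • F
  have hz₀ (s : K) : z₀ s = y s + c * (f s : ℂ) := rfl
  have hz₀n : ‖z₀‖ ≤ 1 + δ := by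
    refine (ContinuousMap.norm_le _ (by positivity)).2 fun s => ?_
    rw [hz₀]
    by_cases hs : s ∈ {s | ‖x s - x t₀‖ < δ} ∩ {s | ‖y s - y t₀‖ < δ}
    · have h1 : y s + c * (f s : ℂ) =
          ((1 - f s : ℝ) : ℂ) * y s + ((f s : ℝ) : ℂ) * (x t₀ + (y s - y t₀)) := by
        simp only [c]
        push_cast
        ring
      rw [h1]
      refine (norm_add_le _ _).trans ?_
      rw [norm_mul, norm_mul, Complex.norm_real, Complex.norm_real,
        Real.norm_of_nonneg (sub_nonneg.2 (hf s).2), Real.norm_of_nonneg (hf s).1]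
      have h2 : ‖y s‖ ≤ 1 := (y.norm_coe_le_norm s).trans hy.le
      have h3 : ‖x t₀ + (y s - y t₀)‖ ≤ 1 + δ :=
        (norm_add_le _ _).trans (add_le_add ht₀.le hs.2.le)
      nlinarith [(hf s).1, (hf s).2]
    · rw [hf0 s hs, Complex.ofReal_zero, mul_zero, add_zero]
      linarith [y.norm_coe_le_norm s]
  have hzt : ‖x t - z₀ t‖ ≤ 2 * δ := by
    have h1 : x t - z₀ t = (x t - x t₀) - (y t - y t₀) := by
      rw [hz₀, hft]
      simp only [c]
      push_cast
      ring
    rw [h1]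
    refine (norm_sub_le _ _).trans ?_
    rw [two_mul]
    exact add_le_add htx.le hty.le
  have hxt : 1 - δ ≤ ‖x t‖ := by
    have h1 := norm_sub_norm_le (x t₀) (x t)
    rw [norm_sub_rev] at h1
    have h2 : ‖x t - x t₀‖ < δ := htx
    linarith
  have hz₀l : 1 - 3 * δ ≤ ‖z₀‖ := by
    have h1 := norm_sub_norm_le (x t) (z₀ t)
    linarith [z₀.norm_coe_le_norm t]
  have hz₀pos : 0 < ‖z₀‖ := by linarith
  let z : C(K, ℂ) := ((‖z₀‖⁻¹ : ℝ) : ℂ) • z₀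
  have hz : ‖z‖ = 1 := by
    rw [norm_smul, Complex.norm_real, norm_inv, norm_norm, inv_mul_cancel₀ hz₀pos.ne']
  have hzz₀ : ‖z₀ - z‖ ≤ 3 * δ := by
    have h1 : z₀ - z = ((1 - ‖z₀‖⁻¹ : ℝ) : ℂ) • z₀ := by
      simp only [z]
      push_cast
      rw [sub_smul, one_smul]
    rw [h1, norm_smul, Complex.norm_real, Real.norm_eq_abs]
    nth_rewrite 2 [← abs_of_pos hz₀pos]
    rw [← abs_mul, sub_mul, one_mul, inv_mul_cancel₀ hz₀pos.ne', abs_le]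
    constructor <;> linarith
  have hyz : y - z = -(c • F) + (z₀ - z) := by
    simp only [z₀]
    abel
  refine ⟨z, mem_sphere_zero_iff_norm.2 hz, ?_, ?_⟩
  · have h1 : ‖T (y - z)‖ ≤ 2 * δ + ‖T‖ * (3 * δ) := by
      rw [hyz, map_add, map_neg, map_smul]
      refine (norm_add_le _ _).trans (add_le_add ?_ ?_)
      · rw [norm_neg, norm_smul]
        gcongr
      · exact (T.le_opNorm _).trans (by gcongr)
    have h2 : ‖φ (y - z)‖ ≤ 2 * δ + ‖φ‖ * (3 * δ) := by
      rw [hyz, map_add, map_neg, map_smul]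
      refine (norm_add_le _ _).trans (add_le_add ?_ ?_)
      · rw [norm_neg, norm_smul]
        gcongr
      · exact (φ.le_opNorm _).trans (by gcongr)
    have h3 : C * δ = 7 * δ + ‖T‖ * (3 * δ) + ‖φ‖ * (3 * δ) := by
      simp only [C]
      ring
    linarith
  · have h1 : ‖x t + z₀ t‖ ≤ ‖x + z₀‖ := (x + z₀).norm_coe_le_norm t
    have h2 : 2 * ‖x t‖ - ‖x t - z₀ t‖ ≤ ‖x t + z₀ t‖ := by
      have h3 : (2 : ℂ) * x t = (x t + z₀ t) + (x t - z₀ t) := by ring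
      have h4 := norm_add_le (x t + z₀ t) (x t - z₀ t)
      rw [← h3, norm_mul, Complex.norm_ofNat] at h4
      linarith
    have h3 : ‖x + z₀‖ ≤ ‖x + z‖ + ‖z₀ - z‖ := by
      have h4 : x + z₀ = (x + z) + (z₀ - z) := by abel
      rw [h4]
      exact norm_add_le _ _
    have h4 : 7 * δ ≤ C * δ := by
      refine mul_le_mul_of_nonneg_right ?_ hδ.le
      simp only [C]
      linarith [norm_nonneg T, norm_nonneg φ]
    linarith

end Compact

/-! ### The Daugavet property from narrowness. -/

section Daugavet

variable {X : Type*} [NormedAddCommGroup X] [NormedSpace ℂ X] {E : Type*}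
  [SeminormedAddCommGroup E] [NormedSpace ℂ E]

/-- Compare with `x + z` by adding `(1 - c) • x` if `c ≤ 1`, and with `c • (x + z)` by adding `(c -
1) • z` otherwise. -/
lemma le_norm_add_smul {x z : X} (hx : ‖x‖ = 1) (hz : ‖z‖ = 1) {δ : ℝ} (hxz : 2 - δ ≤ ‖x + z‖)
    {c : ℝ} (hc : 0 ≤ c) : 1 + c - max 1 c * δ ≤ ‖z + (c : ℂ) • x‖ := by
  rcases le_total c 1 with h | h
  · have h1 : x + z = (z + (c : ℂ) • x) + ((1 - c : ℝ) : ℂ) • x := by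
      push_cast
      rw [sub_smul, one_smul]
      abel
    have h2 := norm_add_le (z + (c : ℂ) • x) (((1 - c : ℝ) : ℂ) • x)
    rw [← h1, norm_smul, hx, Complex.norm_real, Real.norm_of_nonneg (sub_nonneg.2 h)] at h2
    rw [max_eq_left h]
    linarith
  · have h1 : (c : ℂ) • (x + z) = (z + (c : ℂ) • x) + ((c - 1 : ℝ) : ℂ) • z := by
      push_cast
      rw [sub_smul, one_smul, smul_add]
      abel
    have h2 := norm_add_le (z + (c : ℂ) • x) (((c - 1 : ℝ) : ℂ) • z)
    rw [← h1, norm_smul, norm_smul, hz, Complex.norm_real, Complex.norm_real,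
      Real.norm_of_nonneg (sub_nonneg.2 h), Real.norm_of_nonneg hc] at h2
    rw [max_eq_right h]
    nlinarith

/-- A Banach space on which some operator is narrow has the Daugavet property. -/
lemma IsNarrow.hasDaugavetProperty {T : X →L[ℂ] E} (hT : IsNarrow T) :
    HasDaugavetProperty X := by
  intro R hR
  obtain ⟨v, hv0, hv⟩ := finrank_eq_one_iff'.1 hR
  have hv0' : (v : X) ≠ 0 := fun h => hv0 (Subtype.ext h)
  have hnv : ‖(v : X)‖ ≠ 0 := norm_ne_zero_iff.2 hv0'
  obtain ⟨g, -, hgv⟩ := exists_dual_vector ℂ (v : X) hnv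
  let w : X := ((‖(v : X)‖⁻¹ : ℝ) : ℂ) • (v : X)
  have hw : ‖w‖ = 1 := by
    rw [norm_smul, Complex.norm_real, norm_inv, norm_norm, inv_mul_cancel₀ hnv]
  have hgw : g w = 1 := by
    rw [map_smul, hgv, smul_eq_mul]
    change ((‖(v : X)‖⁻¹ : ℝ) : ℂ) * ((‖(v : X)‖ : ℝ) : ℂ) = 1
    rw [← Complex.ofReal_mul, inv_mul_cancel₀ hnv, Complex.ofReal_one]
  have hRw (x : X) : R x = g (R x) • w := by
    obtain ⟨c, hc⟩ := hv ⟨R x, x, rfl⟩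
    have h1 : R x = (c * ‖(v : X)‖) • w := by
      have h2 : c • (v : X) = R x := congrArg Subtype.val hc
      rw [← h2, smul_smul, mul_assoc, ← Complex.ofReal_mul, mul_inv_cancel₀ hnv,
        Complex.ofReal_one, mul_one]
    rw [h1, map_smul, hgw, smul_eq_mul, mul_one]
  have hR0 : R ≠ 0 := by
    rintro rfl
    obtain ⟨x, hx⟩ := v.2
    exact hv0' hx.symm
  refine le_antisymm ((norm_add_le _ _).trans
    (add_le_add_left ContinuousLinearMap.norm_id_le _)) ?_
  refine le_of_forall_pos_sub_le fun ε hε => ?_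
  let C : ℝ := 2 + max 1 ‖R‖
  have hC : 0 < C := by positivity
  let δ : ℝ := min (‖R‖ / 2) (ε / C)
  have hRpos : 0 < ‖R‖ := norm_pos_iff.2 hR0
  have hδ : 0 < δ := by positivity
  have hδR : δ ≤ ‖R‖ / 2 := min_le_left _ _
  have hδC : C * δ ≤ ε := by
    have := min_le_right (‖R‖ / 2) (ε / C)
    rwa [le_div_iff₀ hC, mul_comm] at this
  obtain ⟨y, hy, hRy⟩ : ∃ y : X, ‖y‖ = 1 ∧ ‖R‖ - δ ≤ ‖R y‖ := by
    obtain ⟨y, hy, hRy⟩ := R.exists_nnnorm_eq_one_lt_apply_of_lt_opNNNorm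
      (r := ⟨‖R‖ - δ, by linarith⟩) (NNReal.coe_lt_coe.1 (sub_lt_self _ hδ))
    exact ⟨y, congrArg NNReal.toReal hy, (NNReal.coe_lt_coe.2 hRy).le⟩
  have hRy' : ‖g (R y)‖ = ‖R y‖ := by
    conv_rhs => rw [hRw y, norm_smul, hw, mul_one]
  have hc : 0 < ‖R y‖ := by linarith
  have hc0 : (‖R y‖ : ℂ) ≠ 0 := by exact_mod_cast hc.ne'
  -- Rotating `y` makes `g (R y')` equal to `‖R y‖`. A `z` with `g (R z)` close to this and `‖w +
  -- z‖` close to `2` then has `z + R z` close to `z + ‖R y‖ • w`.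
  let y' : X := (conj (g (R y)) / ‖R y‖) • y
  have hy' : ‖y'‖ = 1 := by
    rw [norm_smul, hy, mul_one, norm_div, Complex.norm_conj, hRy', Complex.norm_real, norm_norm,
      div_self hc.ne']
  have hgy' : g (R y') = ‖R y‖ := by
    rw [map_smul, map_smul, smul_eq_mul, div_mul_eq_mul_div, ← Complex.normSq_eq_conj_mul_self,
      Complex.normSq_eq_norm_sq, hRy', Complex.ofReal_pow, sq, mul_div_cancel_right₀ _ hc0]
  obtain ⟨z, hz, hyz, hwz⟩ := hT w (mem_sphere_zero_iff_norm.2 hw) y'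
    (mem_sphere_zero_iff_norm.2 hy') (g.comp R) δ hδ
  rw [mem_sphere_zero_iff_norm] at hz
  have h1 := le_norm_add_smul hw hz hwz hc.le
  have h2 : ‖g (R (y' - z))‖ ≤ δ := (le_add_of_nonneg_left (norm_nonneg _)).trans hyz
  have h3 : z + (‖R y‖ : ℂ) • w = (ContinuousLinearMap.id ℂ X + R) z + g (R (y' - z)) • w := by
    rw [add_apply, ContinuousLinearMap.id_apply, map_sub, map_sub, hgy', sub_smul,
      ← hRw z]
    abel
  have h4 : ‖z + (‖R y‖ : ℂ) • w‖ ≤ ‖ContinuousLinearMap.id ℂ X + R‖ + δ := by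
    rw [h3]
    refine (norm_add_le _ _).trans (add_le_add ?_ ?_)
    · simpa [hz] using (ContinuousLinearMap.id ℂ X + R).le_opNorm z
    · rwa [norm_smul, hw, mul_one]
  have h5 : max 1 ‖R y‖ * δ ≤ max 1 ‖R‖ * δ := by
    gcongr
    simpa [hy] using R.le_opNorm y
  have h6 : C * δ = 2 * δ + max 1 ‖R‖ * δ := by
    simp only [C]
    ring
  linarith

end Daugavet

/-! ### Rich subspaces and semi-Riesz sets -/

section Main

variable {G : Type*} [CommGroup G] [TopologicalSpace G] [IsTopologicalGroup G] [CompactSpace G]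
  [T2Space G] [MeasurableSpace G] [BorelSpace G]

lemma fourierStieltjes_eq (μ : ComplexMeasure G) (γ : PontryaginDual G) :
    fourierStieltjes μ γ = pairing μ (charFun γ⁻¹) := by
  have h : (fun x => conj (γ x : ℂ)) = charFun γ⁻¹ := by
    ext x
    exact (charFun_inv_apply γ x).symm
  rw [fourierStieltjes, pairing, h]

/-- Translation by `t` multiplies the coefficient by both `γ t` and `δ t`, which differ for some
`t`. -/
lemma fourierCoefficient_charFun_of_ne {γ δ : PontryaginDual G} (h : γ ≠ δ) :
    fourierCoefficient (charFun γ) δ = 0 := by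
  obtain ⟨t, ht⟩ : ∃ t, γ t ≠ δ t := by
    by_contra! h'
    exact h (PontryaginDual.ext h')
  have h1 := fourierCoefficient_translate (charFun γ) t δ
  have h2 : translate (charFun γ) t = (γ t : ℂ) • charFun γ := by
    ext x
    simp
  rw [h2, fourierCoefficient_smul, ← sub_eq_zero, ← sub_mul] at h1
  refine (mul_eq_zero.1 h1).resolve_left fun h3 => ht ?_
  exact Subtype.ext (sub_eq_zero.1 h3)

lemma charFun_mem {Λ : Set (PontryaginDual G)} {γ : PontryaginDual G} (hγ : γ ∈ Λ) :
    charFun γ ∈ continuousWithSpec Λ := by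
  intro δ hδ
  by_contra h
  exact hδ (fourierCoefficient_charFun_of_ne fun h' => h (h' ▸ hγ))

lemma isClosed_continuousWithSpec (Λ : Set (PontryaginDual G)) :
    IsClosed (continuousWithSpec Λ : Set C(G, ℂ)) := by
  have hcont (γ : PontryaginDual G) : Continuous fun f : C(G, ℂ) => fourierCoefficient f γ := by
    refine LipschitzWith.continuous (K := 1) (LipschitzWith.of_dist_le_mul fun f g => ?_)
    rw [dist_eq_norm, dist_eq_norm, NNReal.coe_one, one_mul, fourierCoefficient,
      fourierCoefficient, ← integral_sub (integrable_conj_mul f γ) (integrable_conj_mul g γ)]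
    refine (norm_integral_le_of_norm_le_const (C := ‖f - g‖)
      (Filter.Eventually.of_forall fun x => ?_)).trans (by simp)
    rw [← mul_sub, norm_mul, Complex.norm_conj, Circle.norm_coe, one_mul]
    exact (f - g).norm_coe_le_norm x
  have h : (continuousWithSpec Λ : Set C(G, ℂ)) =
      ⋂ γ ∈ Λᶜ, {f | fourierCoefficient f γ = 0} := by
    ext f
    simp only [Set.mem_iInter, Set.mem_compl_iff, Set.mem_ofPred_eq]
    exact ⟨fun hf γ hγ => by_contra fun h => hγ (hf h), fun hf γ hγ => by_contra fun h =>
      hγ (hf γ h)⟩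
  rw [h]
  exact isClosed_biInter fun γ _ => isClosed_eq (hcont γ) continuous_const

/-- The annihilator of `C_Λ(G)` consists of the measures with spectrum off `Λ⁻¹`. -/
lemma measureSpec_subset_iff {Λ : Set (PontryaginDual G)} {μ : ComplexMeasure G}
    (hμ : IsRegularMeasure μ) :
    measureSpec μ ⊆ Set.univ \ Λ⁻¹ ↔ ∀ f ∈ continuousWithSpec Λ, pairing μ f = 0 := by
  constructor
  · intro h f hf
    refine functional_eq_zero_of_mem_continuousWithSpec (pairingCLM hμ) (fun γ hγ => ?_) hf
    by_contra h'
    refine (h (a := γ⁻¹) ?_).2 (Set.inv_mem_inv.2 hγ)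
    rw [measureSpec, Set.mem_ofPred_eq, fourierStieltjes_eq, inv_inv]
    exact h'
  · intro h γ hγ
    refine ⟨trivial, fun hγΛ => hγ ?_⟩
    rw [fourierStieltjes_eq]
    exact h _ (charFun_mem hγΛ)

/-! ### Isolating the atom of a measure at a point. -/

lemma exists_isOpen_variation_lt {μ : ComplexMeasure G} (hμ : IsRegularMeasure μ) (t : G)
    {ε : ℝ} (hε : 0 < ε) :
    ∃ W : Set G, IsOpen W ∧ t ∈ W ∧ μ.variation.real (W \ {t}) < ε := by
  have : μ.variation.Regular := hμ
  have := hμ.isFiniteMeasure_variation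
  obtain ⟨W, hW, hWo, -, hlt⟩ := (measurableSet_singleton t).exists_isOpen_sdiff_lt
    (μ := μ.variation) (measure_ne_top _ _) (ENNReal.ofReal_pos.2 hε).ne'
  refine ⟨W, hWo, hW rfl, ?_⟩
  exact (ENNReal.toReal_lt_toReal (measure_ne_top _ _) ENNReal.ofReal_ne_top).2 hlt |>.trans_eq
    (ENNReal.toReal_ofReal hε.le)

/-- After the contribution of `{t}` is split off, `f` is bounded by `C` on `W \ {t}`, a set of small
variation in the applications, and by `δ` elsewhere. -/
lemma norm_pairing_sub_le {μ : ComplexMeasure G} (hμ : IsRegularMeasure μ) {f : C(G, ℂ)}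
    {t : G} {W : Set G} (hW : IsOpen W) {C δ : ℝ} (hC : ∀ s, ‖f s‖ ≤ C) (hδ : 0 ≤ δ)
    (hf : ∀ s ∉ W, ‖f s‖ ≤ δ) :
    ‖pairing μ f - f t * μ {t}‖ ≤ C * μ.variation.real (W \ {t}) +
      δ * μ.variation.real Set.univ := by
  have := hμ.isFiniteMeasure_variation
  have ht := measurableSet_singleton t
  have hsingle : (μ.restrict {t}).integral f (ContinuousLinearMap.mul ℝ ℂ) = f t * μ {t} := by
    rw [VectorMeasure.setIntegral_congr_fun (g := fun _ => f t) (fun s hs => by rw [hs]),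
      VectorMeasure.integral_const, VectorMeasure.restrict_apply _ ht MeasurableSet.univ,
      Set.univ_inter]
    rfl
  rw [pairing, ← VectorMeasure.setIntegral_add_compl ht (integrable_continuousMap _ f), hsingle,
    add_sub_cancel_left]
  have hWt : MeasurableSet (W \ {t}) := hW.measurableSet.diff ht
  have hb : Integrable (fun s => C * (W \ {t}).indicator 1 s + δ) μ.variation :=
    (((integrable_const (1 : ℝ)).indicator hWt).const_mul C).add (integrable_const δ)
  have hC0 : 0 ≤ C := (norm_nonneg _).trans (hC t)
  have hb0 (s : G) : 0 ≤ C * (W \ {t}).indicator 1 s + δ :=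
    add_nonneg (mul_nonneg hC0 (Set.indicator_nonneg (fun _ _ => zero_le_one) s)) hδ
  calc _ ≤ ∫ s, ‖f s‖ ∂(μ.restrict {t}ᶜ).variation := by
        simpa using VectorMeasure.norm_integral_le_integral_norm (μ := μ.restrict {t}ᶜ) (f := f)
          (B := ContinuousLinearMap.mul ℝ ℂ)
    _ = ∫ s in {t}ᶜ, ‖f s‖ ∂μ.variation := by rw [VectorMeasure.variation_restrict ht.compl]
    _ ≤ ∫ s in {t}ᶜ, (C * (W \ {t}).indicator 1 s + δ) ∂μ.variation := by
        refine setIntegral_mono_on (integrable_continuousMap _ f).norm.integrableOn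
          hb.integrableOn ht.compl fun s hs => ?_
        by_cases hsW : s ∈ W
        · rw [Set.indicator_of_mem (show s ∈ W \ {t} from ⟨hsW, hs⟩), Pi.one_apply, mul_one]
          exact (hC s).trans (le_add_of_nonneg_right hδ)
        · rw [Set.indicator_of_notMem fun h => hsW h.1, mul_zero, zero_add]
          exact hf s hsW
    _ ≤ ∫ s, (C * (W \ {t}).indicator 1 s + δ) ∂μ.variation :=
        setIntegral_le_integral hb (Filter.Eventually.of_forall hb0)
    _ = _ := by
        have hi : Integrable (fun s => C * (W \ {t}).indicator (1 : G → ℝ) s) μ.variation :=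
          ((integrable_const (1 : ℝ)).indicator hWt).const_mul C
        rw [integral_add hi (integrable_const δ), integral_const_mul, integral_indicator_one hWt, integral_const,
          smul_eq_mul, mul_comm δ]

lemma norm_pairing_le_norm {μ : ComplexMeasure G} (hμ : IsRegularMeasure μ) (f : C(G, ℂ)) :
    ‖pairing μ f‖ ≤ ‖f‖ * μ.variation.real Set.univ := by
  have := hμ.isFiniteMeasure_variation
  refine (norm_pairing_le μ f).trans ((integral_mono (integrable_continuousMap _ f).norm
    (integrable_const ‖f‖) fun x => f.norm_coe_le_norm x).trans ?_)
  simp [mul_comm]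

lemma isDiffuse_of_forall_singleton {μ : ComplexMeasure G} (h : ∀ t, μ {t} = 0) :
    IsDiffuse μ := by
  intro B hB
  have h1 : μ.variation B = 0 := by
    rw [← Set.biUnion_of_singleton B, measure_biUnion_null_iff hB]
    exact fun t _ => variation_singleton_eq_zero (h t)
  have h2 := VectorMeasure.enorm_measure_le_variation μ B
  rwa [h1, nonpos_iff_eq_zero, enorm_eq_zero] at h2

lemma norm_translate (f : C(G, ℂ)) (t : G) : ‖translate f t‖ ≤ ‖f‖ :=
  (ContinuousMap.norm_le _ (norm_nonneg f)).2 fun s => f.norm_coe_le_norm (t * s)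

theorem isSemiRiesz_of_isNarrow {Λ : Set (PontryaginDual G)}
    (hΛ : IsNarrow (continuousWithSpec Λ).mkQL) : IsSemiRiesz (Set.univ \ Λ⁻¹) := by
  intro μ hμ hspec
  rw [measureSpec_subset_iff hμ] at hspec
  refine isDiffuse_of_forall_singleton fun x => ?_
  refine norm_le_zero_iff.1 (le_of_forall_pos_le_add fun ε hε => ?_)
  rw [zero_add]
  let M : ℝ := μ.variation.real Set.univ
  have hM : 0 ≤ M := measureReal_nonneg
  -- The bound `6` on the peak function turns `ε / 12` into `ε / 2`; the other half covers `3 * δ *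
  -- M`, of which `2 * δ * M` comes from approximation by `C_Λ(G)`.
  obtain ⟨W, hW, hxW, hWx⟩ := exists_isOpen_variation_lt hμ x (ε := ε / 12) (by positivity)
  let δ : ℝ := ε / (6 * (M + 1))
  have hδ : 0 < δ := by positivity
  have hδM : 3 * δ * M ≤ ε / 2 := by
    have h1 : δ * (6 * (M + 1)) = ε := div_mul_cancel₀ _ (by positivity)
    nlinarith
  -- The peak `t` is not known in advance, so the neighbourhood of `1` is chosen so that `x * t⁻¹`
  -- moves it into `W` for each of its points `t`.
  have hO : IsOpen {p : G × G | x * p.1⁻¹ * p.2 ∈ W} := hW.preimage (by fun_prop)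
  obtain ⟨U₁, U₂, hU₁, hU₂, h1, h2, hU⟩ := isOpen_prod_iff.1 hO 1 1 (by simpa using hxW)
  obtain ⟨f, t, ht, hft, hf6, hfU, hQ⟩ := hΛ.exists_peak (hU₁.inter hU₂) ⟨1, h1, h2⟩ hδ
  obtain ⟨y, hy, hfy⟩ : ∃ y ∈ continuousWithSpec Λ, ‖f - y‖ < 2 * δ := by
    obtain ⟨k, hk, hkn⟩ := Submodule.Quotient.norm_mk_lt ((continuousWithSpec Λ).mkQ f) hδ
    refine ⟨f - k, ?_, ?_⟩
    · exact (Submodule.Quotient.eq _).1 hk.symm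
    · rw [sub_sub_cancel]
      have h3 : ‖(continuousWithSpec Λ).mkQ f‖ ≤ δ := hQ
      linarith
  let g : C(G, ℂ) := translate f (t * x⁻¹)
  have hgx : g x = 1 := by simp [g, hft]
  have hg6 (s : G) : ‖g s‖ ≤ 6 := (f.norm_coe_le_norm _).trans hf6
  have hgW (s : G) (hs : s ∉ W) : ‖g s‖ ≤ δ := by
    refine hfU _ fun h => hs ?_
    have h3 : x * t⁻¹ * (t * x⁻¹ * s) ∈ W := hU (Set.mk_mem_prod ht.1 h.2)
    have h4 : x * t⁻¹ * (t * x⁻¹ * s) = s := by group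
    rwa [h4] at h3
  have hpg : ‖pairing μ g‖ ≤ 2 * δ * M := by
    have h3 : pairing μ g = pairing μ (translate (f - y) (t * x⁻¹)) := by
      have h4 : translate (f - y) (t * x⁻¹) = g - translate y (t * x⁻¹) := rfl
      rw [h4, ← pairingCLM_apply hμ, ← pairingCLM_apply hμ, map_sub, pairingCLM_apply hμ
        (translate y _), hspec _ (translate_mem_continuousWithSpec hy _), sub_zero]
    rw [h3]
    refine (norm_pairing_le_norm hμ _).trans ?_
    gcongr
    exact (norm_translate _ _).trans hfy.le
  have h3 := norm_pairing_sub_le hμ (t := x) hW hg6 hδ.le hgW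
  rw [hgx, one_mul] at h3
  have h4 := norm_le_insert (pairing μ g) (μ {x})
  change _ ≤ _ + δ * M at h3
  linarith

/-- A finite variation has only countably many atoms. An infinite compact group has no isolated
point, so Haar measure is atomless and nonempty open sets are uncountable. -/
lemma exists_mem_singleton_eq_zero [Infinite G] {U : Set G} (hU : IsOpen U) (hne : U.Nonempty)
    {μ : ComplexMeasure G} (hμ : IsRegularMeasure μ) : ∃ t ∈ U, μ {t} = 0 := by
  have := hμ.isFiniteMeasure_variation
  have hnb : (nhdsWithin (1 : G) {1}ᶜ).NeBot := by
    rw [Filter.neBot_iff, ne_eq, ← isOpen_singleton_iff_punctured_nhds]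
    intro h
    have : DiscreteTopology G := discreteTopology_of_isOpen_singleton_one h
    exact not_finite_iff_infinite.2 ‹Infinite G› finite_of_compact_of_discrete
  by_contra! h
  have hcount : {t : G | 0 < μ.variation {t}}.Countable :=
    Measure.countable_meas_pos_of_disjoint_iUnion (fun t => measurableSet_singleton t)
      (fun s t hst => Set.disjoint_singleton.2 hst)
  have hUc : U.Countable := by
    refine hcount.mono fun t ht => ?_
    refine lt_of_lt_of_le ?_ (VectorMeasure.enorm_measure_le_variation μ {t})
    exact pos_iff_ne_zero.2 fun h' => h t ht (enorm_eq_zero.1 h')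
  exact (hU.measure_pos (normalizedHaar G) hne).ne' (hUc.measure_zero _)

theorem isNarrow_of_isSemiRiesz [Infinite G] {Λ : Set (PontryaginDual G)}
    (hΛ : IsSemiRiesz (Set.univ \ Λ⁻¹)) : IsNarrow (continuousWithSpec Λ).mkQL := by
  refine isNarrow_of_exists_bump fun U hU hne φ δ hδ => ?_
  obtain ⟨μ, hμ, hφμ⟩ := exists_complexMeasure_of_functional φ
  obtain ⟨t, htU, hμt⟩ := exists_mem_singleton_eq_zero hU hne hμ
  by_contra! hcon
  let Y := continuousWithSpec Λ
  let J : C(G, ℝ) →L[ℝ] C(G, ℂ) := Complex.ofRealCLM.compLeftContinuous ℝ G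
  -- Mapping to the product with `ℂ` controls the quotient norm and `φ` by one separation argument.
  let L : C(G, ℝ) →L[ℝ] (C(G, ℂ) ⧸ Y) × ℂ :=
    ((Y.mkQL.prod φ).restrictScalars ℝ).comp J
  let D : Set C(G, ℝ) := {f | f t = 1 ∧ (∀ s ∉ U, f s = 0) ∧ ∀ s, f s ∈ Set.Icc (0 : ℝ) 1}
  have hD : Convex ℝ D := by
    intro f hf g hg a b ha hb hab
    refine ⟨?_, fun s hs => ?_, fun s => ?_⟩
    · simp [hf.1, hg.1, hab]
    · simp [hf.2.1 s hs, hg.2.1 s hs]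
    · exact convex_Icc (0 : ℝ) 1 (hf.2.2 s) (hg.2.2 s) ha hb hab
  have hdisj : Disjoint (Metric.ball (0 : (C(G, ℂ) ⧸ Y) × ℂ) δ) (L '' D) := by
    rw [Set.disjoint_right]
    rintro _ ⟨f, hf, rfl⟩ hball
    rw [mem_ball_zero_iff, Prod.norm_def, max_lt_iff] at hball
    exact (hcon f t htU hf.1 hf.2.1 hf.2.2 hball.1.le).not_ge hball.2.le
  obtain ⟨Ψ, u, hΨu, hΨD⟩ := RCLike.geometric_hahn_banach_open (𝕜 := ℂ) (convex_ball _ δ)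
    Metric.isOpen_ball (hD.linear_image L.toLinearMap) hdisj
  have hu : 0 < u := by simpa using hΨu 0 (Metric.mem_ball_self hδ)
  -- The quotient component of `Ψ` annihilates `C_Λ(G)`; the hypothesis then excludes an atom at
  -- `t`.
  let ψ : C(G, ℂ) →L[ℂ] ℂ := Ψ.comp ((ContinuousLinearMap.inl ℂ (C(G, ℂ) ⧸ Y) ℂ).comp Y.mkQL)
  obtain ⟨ν, hν, hψν⟩ := exists_complexMeasure_of_functional ψ
  have hνt : ν {t} = 0 := by
    refine hΛ ν hν ((measureSpec_subset_iff hν).2 fun f hf => ?_) {t} (Set.countable_singleton t)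
    rw [← hψν]
    have h1 : Y.mkQL f = 0 := (Submodule.Quotient.mk_eq_zero Y).2 hf
    change Ψ (Y.mkQL f, 0) = 0
    rw [h1]
    exact map_zero Ψ
  let c : ℂ := Ψ (0, 1)
  -- With this `η` the functional is at most `η * (1 + ‖c‖) = u / 2` on a narrow bump, below the
  -- separating level `u`.
  let η : ℝ := u / (2 * (1 + ‖c‖))
  have hη : 0 < η := by positivity
  obtain ⟨W₁, hW₁, htW₁, hlt₁⟩ := exists_isOpen_variation_lt hμ t hη
  obtain ⟨W₂, hW₂, htW₂, hlt₂⟩ := exists_isOpen_variation_lt hν t hη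
  obtain ⟨f, hft, hf0, hf⟩ := exists_bump (hU.inter (hW₁.inter hW₂)) (t := t)
    ⟨htU, htW₁, htW₂⟩
  have hJ (s : G) : J f s = (f s : ℂ) := rfl
  have hJ1 (s : G) : ‖J f s‖ ≤ 1 := by
    rw [hJ, Complex.norm_real, Real.norm_of_nonneg (hf s).1]
    exact (hf s).2
  have hμf : ‖φ (J f)‖ ≤ η := by
    have h1 := norm_pairing_sub_le hμ (t := t) hW₁ hJ1 le_rfl fun s hs => by
      rw [hJ, hf0 s fun h => hs h.2.1, Complex.ofReal_zero, norm_zero]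
    rw [hμt, mul_zero, sub_zero, ← hφμ] at h1
    linarith
  have hνf : ‖ψ (J f)‖ ≤ η := by
    have h1 := norm_pairing_sub_le hν (t := t) hW₂ hJ1 le_rfl fun s hs => by
      rw [hJ, hf0 s fun h => hs h.2.2, Complex.ofReal_zero, norm_zero]
    rw [hνt, mul_zero, sub_zero, ← hψν] at h1
    linarith
  have hsplit : Ψ (L f) = ψ (J f) + φ (J f) * c := by
    change Ψ (Y.mkQL (J f), φ (J f)) = Ψ (Y.mkQL (J f), 0) + φ (J f) * Ψ (0, 1)
    rw [← smul_eq_mul, ← map_smul, ← map_add]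
    simp
  have h1 : u ≤ (Ψ (L f)).re :=
    hΨD _ ⟨f, ⟨hft, fun s hs => hf0 s fun h => hs h.1, hf⟩, rfl⟩
  have h2 : ‖Ψ (L f)‖ ≤ η + η * ‖c‖ := by
    rw [hsplit]
    refine (norm_add_le _ _).trans (add_le_add hνf ?_)
    rw [norm_mul]
    gcongr
  have h3 : η * (2 * (1 + ‖c‖)) = u := div_mul_cancel₀ _ (by positivity)
  have h4 := h1.trans ((Complex.re_le_norm _).trans h2)
  linarith

end Main

end HarmonicBanach

theorem mainTheorem1 {G : Type*} [CommGroup G] [TopologicalSpace G] [IsTopologicalGroup G]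
    [CompactSpace G] [T2Space G] [Infinite G] [MeasurableSpace G] [BorelSpace G]
    (Λ : Set (PontryaginDual G)) :
    HarmonicBanach.IsRich (HarmonicBanach.continuousWithSpec Λ) ↔
      HarmonicBanach.IsSemiRiesz (Set.univ \ Λ⁻¹) := by
  refine ⟨fun h => HarmonicBanach.isSemiRiesz_of_isNarrow h.narrow, fun h => ?_⟩
  have hn := HarmonicBanach.isNarrow_of_isSemiRiesz h
  exact ⟨hn.hasDaugavetProperty, HarmonicBanach.isClosed_continuousWithSpec Λ, hn⟩
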